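/- \textbf{Setting.} Let $\beta\in(0,1)$, $\delta\ge 0$ with $\delta\neq 1$, $\rho\in(-1,1)$, $\tilde c_0>0$, $\mu_\eta\in\mathbb R$ and $\gamma_u,\gamma_\xi,\gamma_\eta>0$. Write $LN(\mu,\gamma)$ for the law of $e^X$ with $X\sim N(\mu,\gamma)$ ($\gamma$ the variance), and let $u(w)=w^{1-\delta}/(1-\delta)$, $r(w)=u(w)/(1-\beta)$ and $c_0=u(\tilde c_0)$. Let $Z_t=(w_t,\theta_t)$ be the Markov process on $\mathsf Z=(0,\infty)^2$ with $$\ln\theta_{t+1}=\rho\ln\theta_t+\ln u_{t+1},\qquad w_{t+1}=\eta_{t+1}+\theta_{t+1}\xi_{t+1},$$ where the shocks $u_t\sim LN(0,\gamma_u)$, $\xi_t\sim LN(0,\gamma_\xi)$, $\eta_t\sim LN(\mu_\eta,\gamma_\eta)$ are i.i.d. over time and independent of each other. Let $\mathbb P_z$, $\mathbb E_z$ be its law and expectation on the sequence space given $Z_0=z$, and let $\mathbb E_\theta$ be the expectation of functions of $(Z_1,Z_2,\dots)$ given $\theta_0=\theta$ (this does not depend on $w_0$). We write $(w',\theta')$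 for $Z_1$. Define $$v^*(z)=\sup_\tau \mathbb E_z\Big\{\sum_{t=0}^{\tau-1}\beta^t c_0+\beta^\tau r(w_\tau)\Big\},\qquad \psi^*(\theta)=c_0+\beta\,\mathbb E_\theta v^*(w',\theta'),\qquad Q\psi(\theta)=c_0+\beta\,\mathbb E_\theta\max\{r(w'),\psi(\theta')\},$$ where $\tau$ ranges over the $\mathbb P_z$-a.s. finite stopping times of the filtration generated by $(Z_t)$. A policy $\sigma:\mathsf Z\to\{0,1\}$ is optimal if, for every $z$, $\inf\{t\ge0:\sigma(Z_t)=1\}$ is such a stopping time and attains the supremum. The reservation wage $\bar w(\theta)$ is the wage with $r(\bar w(\theta))=\psi^*(\theta)$. For $n\in\{0,1,2,\dots\}$ put $m=e^{\rho^{2n}(1-\delta)^2\gamma_u}$ and $g(\theta)=\theta^{(1-\delta)\rho^n}+\theta^{-(1-\delta)\rho^n}$. Call $(n,a,b,m',d')$ admissible if $\beta m<1$, $a>0$, $b\ge0$, $m',d'>0$, $m+2m'>1$, $\beta(m+2m')<1$, $d'\ge am/(m+2m'-1)$ and, if $n\ge2$, $\mathbb E_\theta|r(w_n)|\le a\,g(\theta)+b$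 for all $\theta$ (for $n\le 1$ one may take $a=1$, $b=0$). The associated weight function is $$\ell(\theta)=m'\Big(\sum_{t=1}^{n-1}\mathbb E_\theta|r(w_t)|+n|c_0|\Big)+a\,g(\theta)+b+d'.$$ Let $b_\ell$ be the set of measurable $f:(0,\infty)\to\mathbb R$ with $\|f\|_\ell=\sup_\theta|f(\theta)|/\ell(\theta)<\infty$. \textbf{Proposition.} The following hold; all expectations above, and all those in $Q\psi$ for $\psi\in b_\ell$, are those of integrable random variables, and the supremum defining $v^*$ is finite. 0. There is an $n$ with $\beta m<1$, and for every such $n$ there are $a,b,m',d'$ such that $(n,a,b,m',d')$ is admissible. 1. For every admissible choice, $\ell>0$, $Q$ is a contraction mapping of $(b_\ell,\|\cdot\|_\ell)$ into itself, and $\psi^*$ belongs to $b_\ell$ and is the unique fixed point of $Q$ in $b_\ell$. 2. For all $(w,\theta)\in\mathsf Z$, $v^*(w,\theta)=\max\Big\{\dfrac{w^{1-\delta}}{(1-\beta)(1-\delta)},\,\psi^*(\theta)\Big\}$. Moreover $(1-\beta)(1-\delta)\psi^*(\theta)>0$, the reservation wage exists, is unique and equals $\bar w(\theta)=[(1-\beta)(1-\delta)\psi^*(\theta)]^{1/(1-\delta)}$,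 and the policy $\sigma^*(w,\theta)=\mathbf 1\{w\ge\bar w(\theta)\}$ is optimal. 3. $\psi^*$ and $\bar w$ are continuously differentiable on $(0,\infty)$, and $v^*$ is continuous on $\mathsf Z$. 4. $v^*$ is (weakly) increasing in $w$; if $\rho\ge0$, then $\psi^*$, $v^*$ and $\bar w$ are (weakly) increasing in $\theta$. -/

import Mathlib

open MeasureTheory ProbabilityTheory Set
open scoped NNReal

noncomputable section

/-! ### Optimal stopping for a Markov process with stochastic kernel `P` on `Z` -/

namespace OptStop

/-- The law `ℙ_z` on the sequence space `ℕ → Z` of the Markov process `(Z_t)` with stochastic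
kernel `P` started at `Z_0 = z` (Ionescu-Tulcea). -/
def pathMeasure {Z : Type} [MeasurableSpace Z] (P : Kernel Z Z) [IsMarkovKernel P] (z : Z) :
    Measure (ℕ → Z) :=
  Kernel.traj (X := fun _ : ℕ => Z)
    (fun n => P.comap (fun h : (i : Finset.Iic n) → Z => h ⟨n, Finset.mem_Iic.2 le_rfl⟩)
      (measurable_pi_apply _)) 0 (fun _ => z)

/-- `τ` is a stopping time for the filtration generated by `(Z_t)`, finite `ℙ_z`-almost surely. -/
def IsFiniteStoppingTime {Z : Type} [MeasurableSpace Z] (P : Kernel Z Z) [IsMarkovKernel P]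
    (z : Z) (τ : (ℕ → Z) → WithTop ℕ) : Prop :=
  IsStoppingTime (Filtration.piLE (X := fun _ : ℕ => Z)) τ ∧ ∀ᵐ ω ∂(pathMeasure P z), τ ω ≠ ⊤

/-- The realized payoff `∑_{t < τ} β^t c(Z_t) + β^τ r(Z_τ)`. -/
def payoff {Z : Type} (β : ℝ) (r c : Z → ℝ) (τ : (ℕ → Z) → WithTop ℕ) (ω : ℕ → Z) : ℝ :=
  (∑ t ∈ Finset.range ((τ ω).untopD 0), β ^ t * c (ω t))
    + β ^ ((τ ω).untopD 0) * r (ω ((τ ω).untopD 0))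

/-- The value function `v*(z) = sup_τ 𝔼_z {∑_{t < τ} β^t c(Z_t) + β^τ r(Z_τ)}`. -/
def value {Z : Type} [MeasurableSpace Z] (P : Kernel Z Z) [IsMarkovKernel P]
    (β : ℝ) (r c : Z → ℝ) (z : Z) : ℝ :=
  ⨆ τ : {τ : (ℕ → Z) → WithTop ℕ // IsFiniteStoppingTime P z τ},
    ∫ ω, payoff β r c τ.1 ω ∂(pathMeasure P z)

/-- The supremum defining `v*` is meaningful: for every initial state, every admissible payoff is
integrable, and the expected payoffs are bounded above. -/
def ValueWellDefined {Z : Type} [MeasurableSpace Z] (P : Kernel Z Z) [IsMarkovKernel P]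
    (β : ℝ) (r c : Z → ℝ) : Prop :=
  ∀ z, (∀ τ, IsFiniteStoppingTime P z τ → Integrable (payoff β r c τ) (pathMeasure P z)) ∧
    BddAbove (range fun τ : {τ : (ℕ → Z) → WithTop ℕ // IsFiniteStoppingTime P z τ} =>
      ∫ ω, payoff β r c τ.1 ω ∂(pathMeasure P z))

/-- The policy that stops exactly in the states of `S` (i.e. `σ = 𝟙_S`) is optimal: for every
initial state, the first time at which `Z_t ∈ S` is a finite stopping time attaining the supremum
in the definition of the value function. -/
def IsOptimalPolicy {Z : Type} [MeasurableSpace Z] (P : Kernel Z Z) [IsMarkovKernel P]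
    (β : ℝ) (r c : Z → ℝ) (S : Set Z) : Prop :=
  ∀ z, IsFiniteStoppingTime P z (hittingAfter (fun (t : ℕ) (ω : ℕ → Z) => ω t) S 0) ∧
    ∫ ω, payoff β r c (hittingAfter (fun (t : ℕ) (ω : ℕ → Z) => ω t) S 0) ω ∂(pathMeasure P z)
      = value P β r c z

end OptStop

/-! ### Weighted supremum norms -/

/-- `f ∈ b_ℓ Y`: `f` is measurable and `ℓ`-bounded. -/
def MemWeighted {Y : Type} [MeasurableSpace Y] (ℓ f : Y → ℝ) : Prop :=
  Measurable f ∧ BddAbove (range fun y => |f y| / ℓ y)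

/-- The `ℓ`-weighted supremum norm `sup_y |f(y)| / ℓ(y)`. -/
def weightedNorm {Y : Type} (ℓ f : Y → ℝ) : ℝ := ⨆ y, |f y| / ℓ y

/-- `Q` is a contraction mapping of `(b_ℓ Y, ‖·‖_ℓ)` into itself. -/
def IsWeightedContraction {Y : Type} [MeasurableSpace Y] (ℓ : Y → ℝ)
    (Q : (Y → ℝ) → (Y → ℝ)) : Prop :=
  (∀ ψ, MemWeighted ℓ ψ → MemWeighted ℓ (Q ψ)) ∧
    ∃ k : ℝ, 0 ≤ k ∧ k < 1 ∧ ∀ ψ φ, MemWeighted ℓ ψ → MemWeighted ℓ φ →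
      weightedNorm ℓ (Q ψ - Q φ) ≤ k * weightedNorm ℓ (ψ - φ)

/-! ### The job search model -/

/-- The positive half line `(0, ∞)`. -/
abbrev PosReal : Type := Ioi (0 : ℝ)

/-- `f : (0, ∞) → ℝ` is continuously differentiable. -/
def IsC1 (f : PosReal → ℝ) : Prop :=
  ∃ F : ℝ → ℝ, ContDiffOn ℝ 1 F (Ioi 0) ∧ ∀ x : PosReal, F x = f x

/-- The lognormal distribution `LN(μ, γ)`: the law of `exp X` with `X ∼ N(μ, γ)`. -/
def logNormal (μ : ℝ) (γ : ℝ≥0) : Measure PosReal :=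
  (gaussianReal μ γ).map fun x => (⟨Real.exp x, Real.exp_pos x⟩ : PosReal)

lemma measurable_posExp :
    Measurable fun x : ℝ => (⟨Real.exp x, Real.exp_pos x⟩ : PosReal) :=
  Real.measurable_exp.subtype_mk

instance (μ : ℝ) (γ : ℝ≥0) : IsProbabilityMeasure (logNormal μ γ) :=
  Measure.isProbabilityMeasure_map measurable_posExp.aemeasurable

/-- CRRA utility with relative risk aversion `δ`. -/
def crra (δ w : ℝ) : ℝ := if δ = 1 then Real.log w else w ^ (1 - δ) / (1 - δ)

/-- Parameters of the model: discount factor `β`, relative risk aversion `δ`, persistence `ρ`,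
unemployment compensation `comp`, and the lognormal parameters of the shocks
`u ∼ LN(0, γu)`, `ξ ∼ LN(0, γξ)`, `η ∼ LN(μη, γη)`. -/
structure JobSearch where
  β : ℝ
  δ : ℝ
  ρ : ℝ
  comp : ℝ
  μη : ℝ
  γu : ℝ≥0
  γξ : ℝ≥0
  γη : ℝ≥0

namespace JobSearch

/-- Joint law of the independent shocks `(u, ξ, η)`. -/
def shockLaw (M : JobSearch) : Measure (PosReal × PosReal × PosReal) :=
  (logNormal 0 M.γu).prod ((logNormal 0 M.γξ).prod (logNormal M.μη M.γη))

instance (M : JobSearch) : IsProbabilityMeasure M.shockLaw := by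
  unfold shockLaw; infer_instance

/-- The next persistent component: `ln θ' = ρ ln θ + ln u`, i.e. `θ' = θ ^ ρ * u`. -/
def nextTheta (M : JobSearch) (θ u : PosReal) : PosReal :=
  ⟨(θ : ℝ) ^ M.ρ * (u : ℝ), mul_pos (Real.rpow_pos_of_pos θ.2 _) u.2⟩

/-- The wage `w = η + θ ξ`. -/
def wage (θ ξ η : PosReal) : PosReal :=
  ⟨(η : ℝ) + (θ : ℝ) * (ξ : ℝ), mem_Ioi.2 (add_pos (mem_Ioi.1 η.2) (mul_pos θ.2 ξ.2))⟩

/-- The next state `(w', θ')` as a function of `θ` and the shocks `(u, ξ, η)`. -/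
def next (M : JobSearch) (θ : PosReal) (s : PosReal × PosReal × PosReal) : PosReal × PosReal :=
  (wage (M.nextTheta θ s.1) s.2.1 s.2.2, M.nextTheta θ s.1)

lemma measurable_next (M : JobSearch) :
    Measurable fun p : PosReal × PosReal × PosReal × PosReal => M.next p.1 p.2 := by
  have h : Measurable fun p : PosReal × PosReal × PosReal × PosReal => M.nextTheta p.1 p.2.1 := by
    unfold nextTheta
    exact Measurable.subtype_mk (by fun_prop)
  refine Measurable.prodMk ?_ h
  unfold wage
  exact Measurable.subtype_mk (by fun_prop)

/-- The conditional law of the next state `(w', θ')` given the current `θ`. -/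
def thetaKernel (M : JobSearch) : Kernel PosReal (PosReal × PosReal) where
  toFun θ := M.shockLaw.map (M.next θ)
  measurable' := by
    have h : (fun θ => M.shockLaw.map (M.next θ)) = fun θ =>
        (M.shockLaw.map (Prod.mk θ)).map
          fun p : PosReal × PosReal × PosReal × PosReal => M.next p.1 p.2 := by
      funext θ
      rw [Measure.map_map M.measurable_next measurable_prodMk_left]
      rfl
    rw [h]
    exact (Measure.measurable_map _ M.measurable_next).comp Measurable.map_prodMk_left

instance (M : JobSearch) : IsMarkovKernel M.thetaKernel :=
  ⟨fun _ => Measure.isProbabilityMeasure_map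
    (M.measurable_next.comp measurable_prodMk_left).aemeasurable⟩

/-- The stochastic kernel of the state process `Z_t = (w_t, θ_t)`. -/
def kernel (M : JobSearch) : Kernel (PosReal × PosReal) (PosReal × PosReal) :=
  M.thetaKernel.comap Prod.snd measurable_snd

instance (M : JobSearch) : IsMarkovKernel M.kernel := by
  unfold kernel; infer_instance

/-- The exit payoff `r(w) = u(w) / (1 - β)`. -/
def r (M : JobSearch) (w : PosReal) : ℝ := crra M.δ w / (1 - M.β)

/-- The flow continuation payoff, the constant `c₀ = u(comp)`. -/
def c₀ (M : JobSearch) : ℝ := crra M.δ M.comp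

/-- The value function `v*(w, θ)`. -/
def value (M : JobSearch) : PosReal × PosReal → ℝ :=
  OptStop.value M.kernel M.β (fun z => M.r z.1) (fun _ => M.c₀)

/-- The continuation value function
`ψ*(θ) = c₀ + β 𝔼[v*(w', θ') | θ]`. -/
def contValue (M : JobSearch) (θ : PosReal) : ℝ :=
  M.c₀ + M.β * ∫ z, M.value z ∂(M.thetaKernel θ)

/-- The continuation value (Jovanovic) operator
`Qψ(θ) = c₀ + β 𝔼[max {r(w'), ψ(θ')} | θ]`. -/
def Q (M : JobSearch) (ψ : PosReal → ℝ) (θ : PosReal) : ℝ :=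
  M.c₀ + M.β * ∫ z, max (M.r z.1) (ψ z.2) ∂(M.thetaKernel θ)

/-- `stateLaw k θ` is the law of `Z_{k+1} = (w_{k+1}, θ_{k+1})` given `θ_0 = θ`. -/
def stateLaw (M : JobSearch) : ℕ → Kernel PosReal (PosReal × PosReal)
  | 0 => M.thetaKernel
  | k + 1 => M.kernel ∘ₖ stateLaw M k

/-- `𝔼_θ |r(Z_{k+1})|`, which does not depend on the initial wage. -/
def absExit (M : JobSearch) (k : ℕ) (θ : PosReal) : ℝ :=
  ∫ z, |M.r z.1| ∂(M.stateLaw k θ)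

/-- `m = e^{ρ^{2n} (1 - δ)² γu}`. -/
def m (M : JobSearch) (n : ℕ) : ℝ := Real.exp (M.ρ ^ (2 * n) * ((1 - M.δ) ^ 2 * (M.γu : ℝ)))

/-- `g(θ) = θ^{(1-δ) ρ^n} + θ^{-(1-δ) ρ^n}`. -/
def g (M : JobSearch) (n : ℕ) (θ : PosReal) : ℝ :=
  (θ : ℝ) ^ ((1 - M.δ) * M.ρ ^ n) + (θ : ℝ) ^ (-((1 - M.δ) * M.ρ ^ n))

/-- The constants entering the weight function are admissible. The drift bound is
`𝔼_θ g(θ') ≤ m g(θ) + m`, so that `a g + b` has drift constants `m` and `d = a m`. The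
normalization of `g` by `a` and `b` is required to dominate `𝔼_θ |r(Z_n)|` when this expectation
enters the drift of the weight, that is, for `n ≥ 2`; for `n ≤ 1` every `a > 0` and `b ≥ 0` is
allowed, in particular `a = 1`, `b = 0`. -/
structure IsAdmissible (M : JobSearch) (n : ℕ) (a b m' d' : ℝ) : Prop where
  discount : M.β * M.m n < 1
  a_pos : 0 < a
  b_nonneg : 0 ≤ b
  bound : ∀ k, n = k + 2 → ∀ θ, M.absExit (k + 1) θ ≤ a * M.g n θ + b
  m'_pos : 0 < m'
  d'_pos : 0 < d'
  one_lt : 1 < M.m n + 2 * m'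
  lt_one : M.β * (M.m n + 2 * m') < 1
  d'_ge : a * M.m n / (M.m n + 2 * m' - 1) ≤ d'

/-- The weight function
`ℓ(θ) = m' (∑_{t=1}^{n-1} 𝔼_θ |r(Z_t)| + ∑_{t=0}^{n-1} |c₀|) + (a g(θ) + b) + d'`. -/
def ell (M : JobSearch) (n : ℕ) (a b m' d' : ℝ) (θ : PosReal) : ℝ :=
  m' * ((∑ k ∈ Finset.range (n - 1), M.absExit k θ) + n * |M.c₀|) + (a * M.g n θ + b) + d'

end JobSearch

end

/-!
The transition law depends on the state only through `θ`, and so does the value of continuing, so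
`ψ*` solves a fixed point problem in one variable. Lognormal moments show that `r` has an `n`-step
expectation dominated by `g(θ)`, which grows by at most a factor `m` in expectation; adding the
intermediate expectations `𝔼_θ |r(w_t)|` absorbs the unbounded exit payoff and makes `ℓ` a drift
weight with growth `m + 2m'`. As `β (m + 2m') < 1`, `Q` is a contraction of `b_ℓ`.

Let `ψ` be its fixed point. Then `v = max {r, ψ}` is excessive, and it satisfies Bellman's equation
with stopping region `{ψ ≤ r}`. Telescoping `β^t v(Z_t)` along the path identifies `v` with the
value function once the region is known to be reached almost surely. This holds because `ln θ` is a
stable autoregression, hence tight, while from any bounded range of `ln θ` the next wage exceeds a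
continuous reservation wage with probability bounded below. Continuity is available since
integrating against the Gaussian law of `ln θ'` makes `Qψ` continuously differentiable even when
`ψ` is only measurable. The sign of `ψ` and its monotonicity in `θ` are inherited from the iterates
of `Q` started at zero.
-/

noncomputable section

section WeightedNorm

open Filter Topology

variable {Y : Type} {ℓ f g : Y → ℝ}

lemma weightedNorm_nonneg (hℓ : ∀ y, 0 < ℓ y) : 0 ≤ weightedNorm ℓ f :=
  Real.iSup_nonneg fun y => div_nonneg (abs_nonneg _) (hℓ y).le

lemma weightedNorm_le (hℓ : ∀ y, 0 < ℓ y) {B : ℝ} (hB : 0 ≤ B) (h : ∀ y, |f y| ≤ B * ℓ y) :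
    weightedNorm ℓ f ≤ B :=
  Real.iSup_le (fun y => (div_le_iff₀ (hℓ y)).2 (h y)) hB

variable [MeasurableSpace Y]

lemma MemWeighted.abs_le (hf : MemWeighted ℓ f) (hℓ : ∀ y, 0 < ℓ y) (y : Y) :
    |f y| ≤ weightedNorm ℓ f * ℓ y := by
  rw [← div_le_iff₀ (hℓ y)]
  exact le_ciSup hf.2 y

lemma MemWeighted.of_abs_le (hℓ : ∀ y, 0 < ℓ y) (hf : Measurable f) {B : ℝ}
    (hB : ∀ y, |f y| ≤ B * ℓ y) : MemWeighted ℓ f := by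
  refine ⟨hf, B, ?_⟩
  rintro _ ⟨y, rfl⟩
  exact (div_le_iff₀ (hℓ y)).2 (hB y)

lemma MemWeighted.zero : MemWeighted ℓ (0 : Y → ℝ) :=
  ⟨measurable_zero, 0, by rintro _ ⟨y, rfl⟩; simp⟩

lemma MemWeighted.sub (hf : MemWeighted ℓ f) (hg : MemWeighted ℓ g) (hℓ : ∀ y, 0 < ℓ y) :
    MemWeighted ℓ (f - g) := by
  refine .of_abs_le hℓ (hf.1.sub hg.1) (B := weightedNorm ℓ f + weightedNorm ℓ g) fun y => ?_
  rw [add_mul]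
  exact (abs_sub _ _).trans (add_le_add (hf.abs_le hℓ y) (hg.abs_le hℓ y))

lemma MemWeighted.max (hf : MemWeighted ℓ f) (hg : MemWeighted ℓ g) (hℓ : ∀ y, 0 < ℓ y) :
    MemWeighted ℓ fun y => max (f y) (g y) := by
  refine .of_abs_le hℓ (hf.1.max hg.1) (B := weightedNorm ℓ f ⊔ weightedNorm ℓ g) fun y => ?_
  rw [max_mul_of_nonneg _ _ (hℓ y).le]
  exact abs_max_le_max_abs_abs.trans (max_le_max (hf.abs_le hℓ y) (hg.abs_le hℓ y))

lemma exists_memWeighted_tendsto_of_geometric (hℓ : ∀ y, 0 < ℓ y) {F : ℕ → Y → ℝ} {k N : ℝ}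
    (hk : k < 1) (hF : ∀ j, MemWeighted ℓ (F j))
    (hstep : ∀ j y, |F j y - F (j + 1) y| ≤ N * ℓ y * k ^ j) :
    ∃ ψ, MemWeighted ℓ ψ ∧ ∀ j y, |F j y - ψ y| ≤ N * ℓ y * k ^ j / (1 - k) := by
  have hlim (y : Y) : ∃ x, Tendsto (fun j => F j y) atTop (𝓝 x) :=
    cauchySeq_tendsto_of_complete (cauchySeq_of_le_geometric k _ hk fun j => hstep j y)
  choose ψ hψ using hlim
  have hrate (j : ℕ) (y : Y) : |F j y - ψ y| ≤ N * ℓ y * k ^ j / (1 - k) :=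
    dist_le_of_le_geometric_of_tendsto k _ hk (fun j => hstep j y) (hψ y) j
  have hψm : Measurable ψ :=
    measurable_of_tendsto_metrizable (fun j => (hF j).1) (tendsto_pi_nhds.2 hψ)
  refine ⟨ψ, .of_abs_le hℓ hψm (B := weightedNorm ℓ (F 0) + N / (1 - k)) fun y => ?_, hrate⟩
  calc |ψ y| = |F 0 y - (F 0 y - ψ y)| := by rw [sub_sub_cancel]
    _ ≤ |F 0 y| + |F 0 y - ψ y| := abs_sub _ _
    _ ≤ weightedNorm ℓ (F 0) * ℓ y + N * ℓ y * k ^ 0 / (1 - k) :=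
        add_le_add ((hF 0).abs_le hℓ y) (hrate 0 y)
    _ = _ := by ring

namespace IsWeightedContraction

variable {Q : (Y → ℝ) → Y → ℝ} {ψ φ : Y → ℝ}

lemma memWeighted_iterate (hQ : IsWeightedContraction ℓ Q) (hψ : MemWeighted ℓ ψ) (j : ℕ) :
    MemWeighted ℓ (Q^[j] ψ) := by
  induction j with
  | zero => exact hψ
  | succ j ih =>
    rw [Function.iterate_succ_apply']
    exact hQ.1 _ ih

lemma exists_abs_iterate_sub_le (hQ : IsWeightedContraction ℓ Q) (hℓ : ∀ y, 0 < ℓ y) :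
    ∃ k, 0 ≤ k ∧ k < 1 ∧ ∀ ψ φ, MemWeighted ℓ ψ → MemWeighted ℓ φ → ∀ j y,
      |(Q^[j] ψ) y - (Q^[j] φ) y| ≤ weightedNorm ℓ (ψ - φ) * ℓ y * k ^ j := by
  obtain ⟨k, hk0, hk1, hk⟩ := hQ.2
  refine ⟨k, hk0, hk1, fun ψ φ hψ hφ j y => ?_⟩
  have hnorm : weightedNorm ℓ (Q^[j] ψ - Q^[j] φ) ≤ k ^ j * weightedNorm ℓ (ψ - φ) := by
    induction j with
    | zero => simp
    | succ j ih =>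
      rw [Function.iterate_succ_apply', Function.iterate_succ_apply', pow_succ', mul_assoc]
      exact (hk _ _ (hQ.memWeighted_iterate hψ j) (hQ.memWeighted_iterate hφ j)).trans
        (mul_le_mul_of_nonneg_left ih hk0)
  calc |(Q^[j] ψ) y - (Q^[j] φ) y| ≤ weightedNorm ℓ (Q^[j] ψ - Q^[j] φ) * ℓ y :=
        ((hQ.memWeighted_iterate hψ j).sub (hQ.memWeighted_iterate hφ j) hℓ).abs_le hℓ y
    _ ≤ k ^ j * weightedNorm ℓ (ψ - φ) * ℓ y := mul_le_mul_of_nonneg_right hnorm (hℓ y).le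
    _ = _ := by ring

lemma tendsto_iterate (hQ : IsWeightedContraction ℓ Q) (hℓ : ∀ y, 0 < ℓ y)
    (hψ : MemWeighted ℓ ψ) (hφ : MemWeighted ℓ φ) (hfix : Q ψ = ψ) (y : Y) :
    Tendsto (fun j => (Q^[j] φ) y) atTop (𝓝 (ψ y)) := by
  obtain ⟨k, hk0, hk1, hk⟩ := hQ.exists_abs_iterate_sub_le hℓ
  have hzero : Tendsto (fun j : ℕ => weightedNorm ℓ (φ - ψ) * ℓ y * k ^ j) atTop (𝓝 0) := by
    simpa using (tendsto_pow_atTop_nhds_zero_of_lt_one hk0 hk1).const_mul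
      (weightedNorm ℓ (φ - ψ) * ℓ y)
  refine tendsto_iff_dist_tendsto_zero.2 (squeeze_zero (fun _ => dist_nonneg) (fun j => ?_) hzero)
  simpa only [Real.dist_eq, Function.iterate_fixed hfix] using hk φ ψ hφ hψ j y

lemma eq_of_fixed (hQ : IsWeightedContraction ℓ Q) (hℓ : ∀ y, 0 < ℓ y) (hψ : MemWeighted ℓ ψ)
    (hφ : MemWeighted ℓ φ) (hfixψ : Q ψ = ψ) (hfixφ : Q φ = φ) : ψ = φ := by
  funext y
  have h := hQ.tendsto_iterate hℓ hψ hφ hfixψ y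
  simp only [Function.iterate_fixed hfixφ] at h
  exact tendsto_nhds_unique h tendsto_const_nhds

lemma exists_fixed (hQ : IsWeightedContraction ℓ Q) (hℓ : ∀ y, 0 < ℓ y) :
    ∃ ψ, MemWeighted ℓ ψ ∧ Q ψ = ψ := by
  obtain ⟨k, hk0, hk1, hk⟩ := hQ.exists_abs_iterate_sub_le hℓ
  have hmem := hQ.memWeighted_iterate (ψ := 0) .zero
  set N := weightedNorm ℓ (0 - Q 0)
  have hN : 0 ≤ N := weightedNorm_nonneg hℓ
  obtain ⟨ψ, hψ, hrate⟩ := exists_memWeighted_tendsto_of_geometric hℓ hk1 hmem fun j y => by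
    simpa only [Function.iterate_succ_apply] using hk 0 (Q 0) .zero (hQ.1 0 .zero) j y
  refine ⟨ψ, hψ, funext fun y => ?_⟩
  have hnorm (j : ℕ) : weightedNorm ℓ (Q^[j] 0 - ψ) ≤ N * k ^ j / (1 - k) :=
    weightedNorm_le hℓ (div_nonneg (by positivity) (sub_nonneg.2 hk1.le)) fun y =>
      (hrate j y).trans_eq (by ring)
  have hzero (a : ℝ) : Tendsto (fun j : ℕ => a * k ^ j) atTop (𝓝 0) := by
    simpa using (tendsto_pow_atTop_nhds_zero_of_lt_one hk0 hk1).const_mul a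
  refine tendsto_nhds_unique (f := fun j => (Q^[j + 1] 0) y) (l := atTop) ?_ ?_
  · refine tendsto_iff_dist_tendsto_zero.2 (squeeze_zero (fun _ => dist_nonneg) (fun j => ?_)
      (hzero (N / (1 - k) * ℓ y * k)))
    calc dist ((Q^[j + 1] 0) y) (Q ψ y) ≤ weightedNorm ℓ (Q^[j] 0 - ψ) * ℓ y * k ^ 1 := by
          simpa only [Real.dist_eq, Function.iterate_succ_apply', Function.iterate_zero, id_eq]
            using hk _ _ (hmem j) hψ 1 y
      _ ≤ N * k ^ j / (1 - k) * ℓ y * k ^ 1 := by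
          have := (hℓ y).le
          gcongr
          exact hnorm j
      _ = _ := by ring
  · refine (tendsto_add_atTop_iff_nat (f := fun j => (Q^[j] 0) y) 1).2
      (tendsto_iff_dist_tendsto_zero.2 (squeeze_zero (fun _ => dist_nonneg) (fun j => ?_)
        (hzero (N * ℓ y / (1 - k)))))
    exact (hrate j y).trans_eq (by ring)

lemma fixed_mem_of_isClosed (hQ : IsWeightedContraction ℓ Q) (hℓ : ∀ y, 0 < ℓ y)
    (hψ : MemWeighted ℓ ψ) (hfix : Q ψ = ψ) {S : Set (Y → ℝ)} (hS : IsClosed S)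
    (hQS : ∀ φ, MemWeighted ℓ φ → φ ∈ S → Q φ ∈ S) (hφ : MemWeighted ℓ φ) (hφS : φ ∈ S) :
    ψ ∈ S := by
  refine hS.mem_of_tendsto (tendsto_pi_nhds.2 (hQ.tendsto_iterate hℓ hψ hφ hfix))
    (Eventually.of_forall fun j => ?_)
  induction j with
  | zero => exact hφS
  | succ j ih =>
    rw [Function.iterate_succ_apply']
    exact hQS _ (hQ.memWeighted_iterate hφ j) ih

end IsWeightedContraction

end WeightedNorm

namespace OptStop

open Preorder
open scoped ENNReal

section PathMeasure

variable {Z : Type} [MeasurableSpace Z] {P : Kernel Z Z} [IsMarkovKernel P] {z : Z} {n : ℕ}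
  {A : Set (ℕ → Z)}

instance : IsProbabilityMeasure (pathMeasure P z) := by
  unfold pathMeasure; infer_instance

lemma measurableSet_of_piLE (hA : MeasurableSet[Filtration.piLE (X := fun _ : ℕ => Z) n] A) :
    MeasurableSet A :=
  (Filtration.piLE (X := fun _ : ℕ => Z)).le n _ hA

lemma map_eval_zero_pathMeasure :
    (pathMeasure P z).map (fun ω => ω 0) = Measure.dirac z := by
  have h : (fun ω : ℕ → Z => ω 0) =
      (fun x : (i : Finset.Iic 0) → Z => x ⟨0, Finset.mem_Iic.2 le_rfl⟩) ∘
        frestrictLe (π := fun _ => Z) 0 := rfl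
  rw [h, ← Measure.map_map (g := fun x : (i : Finset.Iic 0) → Z => x ⟨0, Finset.mem_Iic.2 le_rfl⟩)
      (measurable_pi_apply _) (measurable_frestrictLe 0), pathMeasure,
    Kernel.traj_map_frestrictLe_apply, Kernel.partialTraj_self, Kernel.id_apply]
  exact Measure.map_dirac' (measurable_pi_apply _) _

lemma map_history_next_pathMeasure :
    (pathMeasure P z).map (fun ω => (frestrictLe (π := fun _ => Z) n ω, ω (n + 1))) =
      ((pathMeasure P z).map (frestrictLe (π := fun _ => Z) n)) ⊗ₘ
        P.comap (fun h : (i : Finset.Iic n) → Z => h ⟨n, Finset.mem_Iic.2 le_rfl⟩)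
          (measurable_pi_apply _) := by
  rw [pathMeasure, Kernel.traj_map_frestrictLe_apply]
  exact (Kernel.partialTraj_compProd_eq_map_traj (X := fun _ => Z) (Nat.zero_le n)).symm

lemma map_eval_succ_restrict_pathMeasure
    (hA : MeasurableSet[Filtration.piLE (X := fun _ : ℕ => Z) n] A) :
    ((pathMeasure P z).restrict A).map (fun ω => ω (n + 1)) =
      P ∘ₘ ((pathMeasure P z).restrict A).map (fun ω => ω n) := by
  rw [Filtration.piLE_eq_comap_frestrictLe] at hA
  obtain ⟨B, hB, rfl⟩ := hA
  ext s hs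
  have hmeas : Measurable fun ω : ℕ → Z => (frestrictLe (π := fun _ => Z) n ω, ω (n + 1)) := by
    fun_prop
  calc ((pathMeasure P z).restrict (frestrictLe n ⁻¹' B)).map (fun ω => ω (n + 1)) s
      = (pathMeasure P z).map (fun ω => (frestrictLe (π := fun _ => Z) n ω, ω (n + 1)))
          (B ×ˢ s) := by
        rw [Measure.map_apply (measurable_pi_apply _) hs,
          Measure.restrict_apply (measurable_pi_apply _ hs), Measure.map_apply hmeas (hB.prod hs),
          inter_comm, mk_preimage_prod]
    _ = ∫⁻ ω in frestrictLe n ⁻¹' B, P (ω n) s ∂(pathMeasure P z) := by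
        rw [map_history_next_pathMeasure, Measure.compProd_apply_prod hB hs,
          setLIntegral_map hB (Kernel.measurable_coe _ hs) (by fun_prop)]
        rfl
    _ = _ := by
        rw [Measure.bind_apply hs P.aemeasurable,
          lintegral_map (Kernel.measurable_coe _ hs) (measurable_pi_apply _)]

lemma lintegral_eval_zero {f : Z → ℝ≥0∞} (hf : Measurable f) :
    ∫⁻ ω, f (ω 0) ∂(pathMeasure P z) = f z := by
  rw [← lintegral_map hf (measurable_pi_apply 0), map_eval_zero_pathMeasure, lintegral_dirac' _ hf]

lemma setLIntegral_eval_succ {f : Z → ℝ≥0∞} (hf : Measurable f)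
    (hA : MeasurableSet[Filtration.piLE (X := fun _ : ℕ => Z) n] A) :
    ∫⁻ ω in A, f (ω (n + 1)) ∂(pathMeasure P z) =
      ∫⁻ ω in A, ∫⁻ y, f y ∂(P (ω n)) ∂(pathMeasure P z) := by
  rw [← lintegral_map hf (measurable_pi_apply (n + 1)), map_eval_succ_restrict_pathMeasure hA,
    Measure.lintegral_bind P.aemeasurable hf.aemeasurable,
    lintegral_map hf.lintegral_kernel (measurable_pi_apply n)]

lemma lintegral_eval_succ {f : Z → ℝ≥0∞} (hf : Measurable f) :
    ∫⁻ ω, f (ω (n + 1)) ∂(pathMeasure P z) =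
      ∫⁻ ω, ∫⁻ y, f y ∂(P (ω n)) ∂(pathMeasure P z) := by
  simpa only [setLIntegral_univ] using
    setLIntegral_eval_succ (P := P) (z := z) (n := n) hf MeasurableSet.univ

lemma integral_eval_zero {f : Z → ℝ} (hf : Measurable f) :
    ∫ ω, f (ω 0) ∂(pathMeasure P z) = f z := by
  rw [← integral_map (φ := fun ω : ℕ → Z => ω 0) (measurable_pi_apply 0).aemeasurable
    hf.aestronglyMeasurable, map_eval_zero_pathMeasure,
    integral_dirac' _ _ hf.stronglyMeasurable]

lemma integrable_eval_zero {f : Z → ℝ} (hf : Measurable f) :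
    Integrable (fun ω => f (ω 0)) (pathMeasure P z) := by
  rw [← Function.comp_def f, ← integrable_map_measure hf.aestronglyMeasurable
    (measurable_pi_apply 0).aemeasurable, map_eval_zero_pathMeasure]
  exact integrable_dirac' hf.stronglyMeasurable enorm_lt_top

lemma integrable_eval_succ {f : Z → ℝ} (hf : Measurable f) (hP : ∀ y, Integrable f (P y))
    (hi : Integrable (fun ω => ∫ y, |f y| ∂(P (ω n))) (pathMeasure P z)) :
    Integrable (fun ω => f (ω (n + 1))) (pathMeasure P z) := by
  have hmap := map_eval_succ_restrict_pathMeasure (P := P) (z := z) (n := n) MeasurableSet.univ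
  rw [Measure.restrict_univ] at hmap
  rw [← Function.comp_def f, ← integrable_map_measure hf.aestronglyMeasurable
    (measurable_pi_apply (n + 1)).aemeasurable, hmap,
    Measure.integrable_comp_iff hf.aestronglyMeasurable]
  refine ⟨ae_of_all _ hP, (integrable_map_measure (f := fun ω : ℕ → Z => ω n) ?_
    (measurable_pi_apply n).aemeasurable).2 hi⟩
  exact hf.stronglyMeasurable.norm.integral_kernel.aestronglyMeasurable

lemma setIntegral_eval_succ {f : Z → ℝ} (hf : Measurable f)
    (hA : MeasurableSet[Filtration.piLE (X := fun _ : ℕ => Z) n] A)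
    (hi : Integrable (fun ω => f (ω (n + 1))) (pathMeasure P z)) :
    ∫ ω in A, f (ω (n + 1)) ∂(pathMeasure P z) =
      ∫ ω in A, ∫ y, f y ∂(P (ω n)) ∂(pathMeasure P z) := by
  have hi' : Integrable f (((pathMeasure P z).restrict A).map fun ω => ω (n + 1)) :=
    (integrable_map_measure hf.aestronglyMeasurable (measurable_pi_apply _).aemeasurable).2
      hi.integrableOn
  rw [map_eval_succ_restrict_pathMeasure hA] at hi'
  rw [← integral_map (φ := fun ω : ℕ → Z => ω (n + 1)) (measurable_pi_apply _).aemeasurable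
    hf.aestronglyMeasurable, map_eval_succ_restrict_pathMeasure hA]
  rw [Measure.comp_eq_comp_const_apply] at hi' ⊢
  rw [Kernel.integral_comp hi', Kernel.const_apply,
    integral_map (measurable_pi_apply n).aemeasurable]
  exact hf.stronglyMeasurable.integral_kernel.aestronglyMeasurable

end PathMeasure

end OptStop

section DriftWeight

variable {Y Z : Type} [MeasurableSpace Y] [MeasurableSpace Z]

/-- `ℓ` is a weight on `Y` whose conditional expectation grows at most by the factor `K` when the
state `y` is replaced by the component `π z` of a `κ y`-distributed `z`. A weight for a Markov
kernel on `Z` itself is the case `π = id`. -/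
structure IsDriftWeight (κ : Kernel Y Z) (π : Z → Y) (ℓ : Y → ℝ) (K : ℝ) : Prop where
  measurable_proj : Measurable π
  measurable : Measurable ℓ
  pos : ∀ y, 0 < ℓ y
  growth_nonneg : 0 ≤ K
  integrable : ∀ y, Integrable (fun z => ℓ (π z)) (κ y)
  drift : ∀ y, ∫ z, ℓ (π z) ∂(κ y) ≤ K * ℓ y

namespace IsDriftWeight

variable {κ : Kernel Y Z} {π : Z → Y} {ℓ f : Y → ℝ} {K : ℝ}

lemma integrable_of_memWeighted (hℓ : IsDriftWeight κ π ℓ K) (hf : MemWeighted ℓ f) (y : Y) :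
    Integrable (fun z => f (π z)) (κ y) :=
  ((hℓ.integrable y).const_mul (weightedNorm ℓ f)).mono'
    (hf.1.comp hℓ.measurable_proj).aestronglyMeasurable
    (ae_of_all _ fun z => hf.abs_le hℓ.pos (π z))

lemma integral_abs_le (hℓ : IsDriftWeight κ π ℓ K) (hf : MemWeighted ℓ f) (y : Y) :
    ∫ z, |f (π z)| ∂(κ y) ≤ weightedNorm ℓ f * K * ℓ y := by
  calc ∫ z, |f (π z)| ∂(κ y) ≤ ∫ z, weightedNorm ℓ f * ℓ (π z) ∂(κ y) :=
        integral_mono (hℓ.integrable_of_memWeighted hf y).abs ((hℓ.integrable y).const_mul _)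
          fun z => hf.abs_le hℓ.pos (π z)
    _ ≤ weightedNorm ℓ f * (K * ℓ y) := by
        rw [integral_const_mul]
        exact mul_le_mul_of_nonneg_left (hℓ.drift y) (weightedNorm_nonneg hℓ.pos)
    _ = _ := by ring

lemma memWeighted_integral (hℓ : IsDriftWeight κ π ℓ K)
    (hf : MemWeighted ℓ f) : MemWeighted ℓ fun y => ∫ z, f (π z) ∂(κ y) :=
  .of_abs_le hℓ.pos
    ((hf.1.comp hℓ.measurable_proj).stronglyMeasurable.integral_kernel (κ := κ)).measurable
    fun y => abs_integral_le_integral_abs.trans (hℓ.integral_abs_le hf y)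

end IsDriftWeight

end DriftWeight

lemma integrable_tsum_of_summable_integral_norm {α : Type*} [MeasurableSpace α] {μ : Measure α}
    {F : ℕ → α → ℝ} (hF : ∀ j, Measurable (F j)) (hi : ∀ j, Integrable (F j) μ)
    (hs : Summable fun j => ∫ a, ‖F j a‖ ∂μ) : Integrable (fun a => ∑' j, F j a) μ := by
  refine ⟨(Measurable.tsum hF).aestronglyMeasurable, ?_⟩
  calc ∫⁻ a, ‖∑' j, F j a‖ₑ ∂μ ≤ ∫⁻ a, ∑' j, ‖F j a‖ₑ ∂μ :=
        lintegral_mono fun a => enorm_tsum_le_tsum_enorm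
    _ = ∑' j, ENNReal.ofReal (∫ a, ‖F j a‖ ∂μ) := by
        rw [lintegral_tsum fun j => (hF j).enorm.aemeasurable]
        exact tsum_congr fun j => (ofReal_integral_norm_eq_lintegral_enorm (hi j)).symm
    _ < ⊤ := hs.tsum_ofReal_lt_top

namespace OptStop

variable {Z : Type}

/-- The discounted gain `β^j (c(Z_j) + β f(Z_{j+1}) - f(Z_j))` from waiting in period `j` when the
state is valued by `f`. -/
def increment (β : ℝ) (c f : Z → ℝ) (j : ℕ) (ω : ℕ → Z) : ℝ :=
  β ^ j * (c (ω j) + β * f (ω (j + 1)) - f (ω j))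

lemma add_sum_increment (β : ℝ) (c f : Z → ℝ) (ω : ℕ → Z) (n : ℕ) :
    f (ω 0) + ∑ j ∈ Finset.range n, increment β c f j ω =
      (∑ t ∈ Finset.range n, β ^ t * c (ω t)) + β ^ n * f (ω n) := by
  induction n with
  | zero => simp
  | succ n ih =>
    rw [Finset.sum_range_succ, Finset.sum_range_succ, ← add_assoc, ih, increment]
    ring

lemma payoff_eq_add_tsum_increment (β : ℝ) (c f : Z → ℝ) {τ : (ℕ → Z) → WithTop ℕ} {ω : ℕ → Z}
    (hω : τ ω ≠ ⊤) :
    payoff β f c τ ω =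
      f (ω 0) + ∑' j : ℕ, {ω | (j : WithTop ℕ) < τ ω}.indicator (increment β c f j) ω := by
  obtain ⟨n, hn⟩ := WithTop.ne_top_iff_exists.1 hω
  have hmem (j : ℕ) : ω ∈ {ω | (j : WithTop ℕ) < τ ω} ↔ j < n := by
    rw [mem_ofPred_eq, ← hn]
    exact WithTop.coe_lt_coe
  rw [payoff, ← hn, WithTop.untopD_coe, ← add_sum_increment, tsum_eq_sum (s := Finset.range n)]
  · congr 1
    exact Finset.sum_congr rfl fun j hj =>
      (indicator_of_mem ((hmem j).2 (Finset.mem_range.1 hj)) _).symm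
  · exact fun j hj => indicator_of_notMem (mt (hmem j).1 (mt Finset.mem_range.2 hj)) _

variable [MeasurableSpace Z] {P : Kernel Z Z} [IsMarkovKernel P] {β K : ℝ} {V c f r v : Z → ℝ}
  {z : Z} {τ : (ℕ → Z) → WithTop ℕ}

section Drift

lemma integrable_eval_and_integral_le (hV : IsDriftWeight P id V K) (z : Z) (n : ℕ) :
    Integrable (fun ω => V (ω n)) (pathMeasure P z) ∧
      ∫ ω, V (ω n) ∂(pathMeasure P z) ≤ K ^ n * V z := by
  induction n with
  | zero => simp [integral_eval_zero hV.measurable, integrable_eval_zero hV.measurable]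
  | succ n ih =>
    have hPV : Integrable (fun ω => ∫ y, V y ∂(P (ω n))) (pathMeasure P z) :=
      (ih.1.const_mul K).mono' (hV.measurable.stronglyMeasurable.integral_kernel.measurable.comp
        (measurable_pi_apply n)).aestronglyMeasurable (ae_of_all _ fun ω => by
          rw [Real.norm_of_nonneg (integral_nonneg fun y => (hV.pos y).le)]
          exact hV.drift (ω n))
    have hi : Integrable (fun ω => V (ω (n + 1))) (pathMeasure P z) :=
      integrable_eval_succ hV.measurable hV.integrable (by simpa only [abs_of_pos (hV.pos _)])
    refine ⟨hi, ?_⟩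
    calc ∫ ω, V (ω (n + 1)) ∂(pathMeasure P z)
        = ∫ ω, ∫ y, V y ∂(P (ω n)) ∂(pathMeasure P z) := by
          simpa only [setIntegral_univ] using
            setIntegral_eval_succ hV.measurable MeasurableSet.univ hi
      _ ≤ ∫ ω, K * V (ω n) ∂(pathMeasure P z) :=
          integral_mono hPV (ih.1.const_mul K) fun ω => hV.drift (ω n)
      _ ≤ K * (K ^ n * V z) := by
          rw [integral_const_mul]
          exact mul_le_mul_of_nonneg_left ih.2 hV.growth_nonneg
      _ = _ := by ring

lemma integrable_eval (hV : IsDriftWeight P id V K) (hf : MemWeighted V f) (z : Z) (n : ℕ) :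
    Integrable (fun ω => f (ω n)) (pathMeasure P z) :=
  ((integrable_eval_and_integral_le hV z n).1.const_mul (weightedNorm V f)).mono'
    (hf.1.comp (measurable_pi_apply n)).aestronglyMeasurable
    (ae_of_all _ fun ω => hf.abs_le hV.pos (ω n))

lemma integral_abs_eval_le (hV : IsDriftWeight P id V K) (hf : MemWeighted V f) (z : Z) (n : ℕ) :
    ∫ ω, |f (ω n)| ∂(pathMeasure P z) ≤ weightedNorm V f * (K ^ n * V z) := by
  obtain ⟨hi, hle⟩ := integrable_eval_and_integral_le hV z n
  calc ∫ ω, |f (ω n)| ∂(pathMeasure P z)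
      ≤ ∫ ω, weightedNorm V f * V (ω n) ∂(pathMeasure P z) :=
        integral_mono (integrable_eval hV hf z n).abs (hi.const_mul _)
          fun ω => hf.abs_le hV.pos (ω n)
    _ ≤ _ := by
        rw [integral_const_mul]
        exact mul_le_mul_of_nonneg_left hle (weightedNorm_nonneg hV.pos)

end Drift

section Verification

lemma integrable_increment (hV : IsDriftWeight P id V K) (hc : MemWeighted V c)
    (hf : MemWeighted V f) (j : ℕ) : Integrable (increment β c f j) (pathMeasure P z) :=
  (((integrable_eval hV hc z j).add ((integrable_eval hV hf z (j + 1)).const_mul β)).sub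
    (integrable_eval hV hf z j)).const_mul (β ^ j)

lemma integral_abs_increment_le (hV : IsDriftWeight P id V K) (hβ : 0 ≤ β)
    (hc : MemWeighted V c) (hf : MemWeighted V f) (j : ℕ) :
    ∫ ω, |increment β c f j ω| ∂(pathMeasure P z) ≤
      (weightedNorm V c + β * K * weightedNorm V f + weightedNorm V f) * V z * (β * K) ^ j := by
  have hcj := (integrable_eval hV hc z j).abs
  have hfj := (integrable_eval hV hf z j).abs
  have hfj1 := ((integrable_eval hV hf z (j + 1)).abs).const_mul β
  calc ∫ ω, |increment β c f j ω| ∂(pathMeasure P z)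
      ≤ ∫ ω, β ^ j * (|c (ω j)| + β * |f (ω (j + 1))| + |f (ω j)|) ∂(pathMeasure P z) := by
        refine integral_mono (integrable_increment hV hc hf j).abs
          (((hcj.add hfj1).add hfj).const_mul _) fun ω => ?_
        simp only [increment, abs_mul, abs_pow, abs_of_nonneg hβ]
        gcongr
        refine (abs_sub _ _).trans (add_le_add_left ((abs_add_le _ _).trans_eq ?_) _)
        rw [abs_mul, abs_of_nonneg hβ]
    _ = β ^ j * (∫ ω, |c (ω j)| ∂(pathMeasure P z) + β * ∫ ω, |f (ω (j + 1))| ∂(pathMeasure P z)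
          + ∫ ω, |f (ω j)| ∂(pathMeasure P z)) := by
        rw [integral_const_mul, integral_add ?_ hfj, integral_add hcj hfj1, integral_const_mul]
        exact hcj.add hfj1
    _ ≤ β ^ j * (weightedNorm V c * (K ^ j * V z) + β * (weightedNorm V f * (K ^ (j + 1) * V z))
          + weightedNorm V f * (K ^ j * V z)) := by
        gcongr <;> exact integral_abs_eval_le hV ‹_› z _
    _ = _ := by ring

lemma measurableSet_lt (hτ : IsFiniteStoppingTime P z τ) (j : ℕ) :
    MeasurableSet[Filtration.piLE (X := fun _ : ℕ => Z) j] {ω | (j : WithTop ℕ) < τ ω} :=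
  hτ.1.measurableSet_gt j

lemma integrable_indicator_increment (hV : IsDriftWeight P id V K)
    (hc : MemWeighted V c) (hf : MemWeighted V f) (hτ : IsFiniteStoppingTime P z τ) (j : ℕ) :
    Integrable ({ω | (j : WithTop ℕ) < τ ω}.indicator (increment β c f j)) (pathMeasure P z) :=
  (integrable_increment hV hc hf j).indicator (measurableSet_of_piLE (measurableSet_lt hτ j))

lemma summable_integral_norm_indicator_increment (hV : IsDriftWeight P id V K) (hβ : 0 ≤ β)
    (hβK : β * K < 1) (hc : MemWeighted V c) (hf : MemWeighted V f)
    (hτ : IsFiniteStoppingTime P z τ) :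
    Summable fun j : ℕ => ∫ ω, ‖{ω | (j : WithTop ℕ) < τ ω}.indicator (increment β c f j) ω‖
      ∂(pathMeasure P z) := by
  refine .of_nonneg_of_le (fun j => integral_nonneg fun ω => norm_nonneg _) (fun j => ?_)
    ((summable_geometric_of_lt_one (mul_nonneg hβ hV.growth_nonneg) hβK).mul_left
      ((weightedNorm V c + β * K * weightedNorm V f + weightedNorm V f) * V z))
  refine (integral_mono (integrable_indicator_increment hV hc hf hτ j).norm
    (integrable_increment hV hc hf j).norm fun ω => ?_).trans
    (integral_abs_increment_le hV hβ hc hf j)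
  exact norm_indicator_le_norm_self _ _

lemma payoff_ae_eq (hτ : IsFiniteStoppingTime P z τ) :
    payoff β f c τ =ᵐ[pathMeasure P z] fun ω =>
      f (ω 0) + ∑' j : ℕ, {ω | (j : WithTop ℕ) < τ ω}.indicator (increment β c f j) ω := by
  filter_upwards [hτ.2] with ω hω using payoff_eq_add_tsum_increment β c f hω

lemma integrable_tsum_increment (hV : IsDriftWeight P id V K) (hβ : 0 ≤ β) (hβK : β * K < 1)
    (hc : MemWeighted V c) (hf : MemWeighted V f) (hτ : IsFiniteStoppingTime P z τ) :
    Integrable (fun ω => ∑' j : ℕ,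
      {ω | (j : WithTop ℕ) < τ ω}.indicator (increment β c f j) ω) (pathMeasure P z) := by
  have hcm := hc.1
  have hfm := hf.1
  refine integrable_tsum_of_summable_integral_norm (fun j => Measurable.indicator
    (by unfold increment; fun_prop) (measurableSet_of_piLE (measurableSet_lt hτ j)))
    (integrable_indicator_increment hV hc hf hτ)
    (summable_integral_norm_indicator_increment hV hβ hβK hc hf hτ)

lemma integrable_payoff (hV : IsDriftWeight P id V K) (hβ : 0 ≤ β) (hβK : β * K < 1)
    (hc : MemWeighted V c) (hf : MemWeighted V f) (hτ : IsFiniteStoppingTime P z τ) :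
    Integrable (payoff β f c τ) (pathMeasure P z) :=
  (integrable_congr (payoff_ae_eq hτ)).2 ((integrable_eval hV hf z 0).add
    (integrable_tsum_increment hV hβ hβK hc hf hτ))

lemma setIntegral_increment (hV : IsDriftWeight P id V K) (hc : MemWeighted V c)
    (hf : MemWeighted V f) {j : ℕ} {A : Set (ℕ → Z)}
    (hA : MeasurableSet[Filtration.piLE (X := fun _ : ℕ => Z) j] A) :
    ∫ ω in A, increment β c f j ω ∂(pathMeasure P z) =
      ∫ ω in A, β ^ j * (c (ω j) + β * ∫ y, f y ∂(P (ω j)) - f (ω j)) ∂(pathMeasure P z) := by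
  have hcj := (integrable_eval hV hc z j).integrableOn (s := A)
  have hfj := (integrable_eval hV hf z j).integrableOn (s := A)
  have hfj1 := ((integrable_eval hV hf z (j + 1)).const_mul β).integrableOn (s := A)
  have hPf := ((integrable_eval hV (hV.memWeighted_integral hf) z j).const_mul β).integrableOn
    (s := A)
  simp only [id_eq] at hPf
  simp only [increment]
  rw [integral_const_mul, integral_const_mul, integral_sub ?_ hfj, integral_add hcj hfj1,
    integral_const_mul, setIntegral_eval_succ hf.1 hA (integrable_eval hV hf z (j + 1)),
    integral_sub ?_ hfj, integral_add hcj hPf, integral_const_mul]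
  · exact hcj.add hPf
  · exact hcj.add hfj1

lemma integral_payoff (hV : IsDriftWeight P id V K) (hβ : 0 ≤ β) (hβK : β * K < 1)
    (hc : MemWeighted V c) (hf : MemWeighted V f) (hτ : IsFiniteStoppingTime P z τ) :
    ∫ ω, payoff β f c τ ω ∂(pathMeasure P z) =
      f z + ∑' j : ℕ, ∫ ω in {ω | (j : WithTop ℕ) < τ ω},
        β ^ j * (c (ω j) + β * ∫ y, f y ∂(P (ω j)) - f (ω j)) ∂(pathMeasure P z) := by
  rw [integral_congr_ae (payoff_ae_eq hτ), integral_add (integrable_eval hV hf z 0)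
      (integrable_tsum_increment hV hβ hβK hc hf hτ), integral_eval_zero hf.1,
    ← integral_tsum_of_summable_integral_norm (integrable_indicator_increment hV hc hf hτ)
      (summable_integral_norm_indicator_increment hV hβ hβK hc hf hτ)]
  congr 1
  refine tsum_congr fun j => ?_
  rw [integral_indicator (measurableSet_of_piLE (measurableSet_lt hτ j)),
    setIntegral_increment hV hc hf (measurableSet_lt hτ j)]

lemma integral_payoff_le (hV : IsDriftWeight P id V K) (hβ : 0 ≤ β) (hβK : β * K < 1)
    (hc : MemWeighted V c) (hr : MemWeighted V r) (hv : MemWeighted V v) (hrv : ∀ z, r z ≤ v z)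
    (hPv : ∀ z, c z + β * ∫ y, v y ∂(P z) ≤ v z) (hτ : IsFiniteStoppingTime P z τ) :
    ∫ ω, payoff β r c τ ω ∂(pathMeasure P z) ≤ v z := by
  calc ∫ ω, payoff β r c τ ω ∂(pathMeasure P z) ≤ ∫ ω, payoff β v c τ ω ∂(pathMeasure P z) :=
        integral_mono (integrable_payoff hV hβ hβK hc hr hτ)
          (integrable_payoff hV hβ hβK hc hv hτ) fun ω => by
            unfold payoff
            have := hrv (ω ((τ ω).untopD 0))
            gcongr
    _ ≤ v z := by
        rw [integral_payoff hV hβ hβK hc hv hτ, add_le_iff_nonpos_right]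
        exact tsum_nonpos fun j => integral_nonpos fun ω =>
          mul_nonpos_of_nonneg_of_nonpos (by positivity) (by linarith [hPv (ω j)])

lemma integral_payoff_eq (hV : IsDriftWeight P id V K) (hβ : 0 ≤ β) (hβK : β * K < 1)
    (hc : MemWeighted V c) (hv : MemWeighted V v) (hτ : IsFiniteStoppingTime P z τ)
    (hcont : ∀ (ω : ℕ → Z) (j : ℕ), (j : WithTop ℕ) < τ ω →
      c (ω j) + β * ∫ y, v y ∂(P (ω j)) = v (ω j))
    (hexit : ∀ (ω : ℕ → Z) (j : ℕ), τ ω = j → r (ω j) = v (ω j)) :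
    ∫ ω, payoff β r c τ ω ∂(pathMeasure P z) = v z := by
  have hexit' : payoff β r c τ =ᵐ[pathMeasure P z] payoff β v c τ := by
    filter_upwards [hτ.2] with ω hω
    obtain ⟨n, hn⟩ := WithTop.ne_top_iff_exists.1 hω
    rw [payoff, payoff, ← hn, WithTop.untopD_coe, hexit ω n hn.symm]
  rw [integral_congr_ae hexit', integral_payoff hV hβ hβK hc hv hτ, add_eq_left]
  refine (tsum_congr fun j => ?_).trans tsum_zero
  refine setIntegral_eq_zero_of_forall_eq_zero fun ω hω => ?_
  rw [hcont ω j hω, sub_self, mul_zero]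

lemma valueWellDefined_of_excessive (hV : IsDriftWeight P id V K) (hβ : 0 ≤ β) (hβK : β * K < 1)
    (hc : MemWeighted V c) (hr : MemWeighted V r) (hv : MemWeighted V v) (hrv : ∀ z, r z ≤ v z)
    (hPv : ∀ z, c z + β * ∫ y, v y ∂(P z) ≤ v z) : ValueWellDefined P β r c := by
  refine fun z => ⟨fun τ hτ => integrable_payoff hV hβ hβK hc hr hτ, v z, ?_⟩
  rintro _ ⟨τ, rfl⟩
  exact integral_payoff_le hV hβ hβK hc hr hv hrv hPv τ.2

lemma integral_payoff_hittingAfter (hV : IsDriftWeight P id V K) (hβ : 0 ≤ β) (hβK : β * K < 1)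
    (hc : MemWeighted V c) (hv : MemWeighted V v) {S : Set Z}
    (hS : IsFiniteStoppingTime P z (hittingAfter (fun t ω => ω t) S 0))
    (hmem : ∀ y ∈ S, r y = v y) (hnot : ∀ y ∉ S, c y + β * ∫ x, v x ∂(P y) = v y) :
    ∫ ω, payoff β r c (hittingAfter (fun t ω => ω t) S 0) ω ∂(pathMeasure P z) = v z := by
  refine integral_payoff_eq hV hβ hβK hc hv hS (fun ω j hj => ?_) fun ω j hj => ?_
  · exact hnot _ (notMem_of_lt_hittingAfter (u := fun (t : ℕ) (ω : ℕ → Z) => ω t) hj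
      (Nat.zero_le j))
  · have h := hittingAfter_mem_set_of_ne_top (u := fun (t : ℕ) (ω : ℕ → Z) => ω t) (s := S)
      (n := 0) (ω := ω) (by rw [hj]; exact WithTop.coe_ne_top)
    rw [hj] at h
    exact hmem _ (by rwa [show (j : WithTop ℕ).untopA = j from rfl] at h)

lemma value_eq_and_isOptimalPolicy (hV : IsDriftWeight P id V K) (hβ : 0 ≤ β) (hβK : β * K < 1)
    (hc : MemWeighted V c) (hr : MemWeighted V r) (hv : MemWeighted V v) (hrv : ∀ z, r z ≤ v z)
    (hPv : ∀ z, c z + β * ∫ y, v y ∂(P z) ≤ v z) {S : Set Z}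
    (hS : ∀ z, IsFiniteStoppingTime P z (hittingAfter (fun t ω => ω t) S 0))
    (hmem : ∀ z ∈ S, r z = v z) (hnot : ∀ z ∉ S, c z + β * ∫ y, v y ∂(P z) = v z) :
    value P β r c = v ∧ IsOptimalPolicy P β r c S := by
  have hattained (z : Z) := integral_payoff_hittingAfter hV hβ hβK hc hv (hS z) hmem hnot
  have hvalue (z : Z) : value P β r c z = v z := by
    have : Nonempty {τ : (ℕ → Z) → WithTop ℕ // IsFiniteStoppingTime P z τ} := ⟨⟨_, hS z⟩⟩
    refine le_antisymm
      (ciSup_le fun τ => integral_payoff_le hV hβ hβK hc hr hv hrv hPv τ.2) ?_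
    rw [← hattained z]
    exact le_ciSup (valueWellDefined_of_excessive hV hβ hβK hc hr hv hrv hPv z).2 ⟨_, hS z⟩
  exact ⟨funext hvalue, fun z => ⟨hS z, (hattained z).trans (hvalue z).symm⟩⟩

end Verification

end OptStop

namespace OptStop

open scoped ENNReal

section Recurrence

variable {Z : Type} [MeasurableSpace Z] {P : Kernel Z Z} [IsMarkovKernel P] {S A : Set Z} {z : Z}

lemma isStoppingTime_hittingAfter_eval (hS : MeasurableSet S) :
    IsStoppingTime (Filtration.piLE (X := fun _ : ℕ => Z))
      (hittingAfter (fun (t : ℕ) (ω : ℕ → Z) => ω t) S 0) := by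
  refine Adapted.isStoppingTime_hittingAfter (fun j => ?_) hS
  rw [Filtration.piLE_eq_comap_frestrictLe]
  exact (measurable_pi_apply (⟨j, Finset.mem_Iic.2 le_rfl⟩ : Finset.Iic j)).comp
    (comap_measurable (Preorder.frestrictLe (π := fun _ => Z) j))

lemma mul_measure_le_measure_hittingAfter_eq_succ (hS : MeasurableSet S) (hA : MeasurableSet A)
    {ε : ℝ≥0∞} (hε : ∀ y ∈ A, ε ≤ P y S) (t : ℕ) :
    ε * pathMeasure P z ({ω | (t : WithTop ℕ) < hittingAfter (fun t ω => ω t) S 0 ω} ∩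
        {ω | ω t ∈ A}) ≤
      pathMeasure P z {ω | hittingAfter (fun t ω => ω t) S 0 ω = (t + 1 : ℕ)} := by
  set τ := hittingAfter (fun (t : ℕ) (ω : ℕ → Z) => ω t) S 0
  have hlt := (isStoppingTime_hittingAfter_eval hS).measurableSet_gt t
  have hnext : MeasurableSet ((fun ω : ℕ → Z => ω (t + 1)) ⁻¹' S) := measurable_pi_apply _ hS
  calc ε * pathMeasure P z ({ω | (t : WithTop ℕ) < τ ω} ∩ {ω | ω t ∈ A})
      = ∫⁻ _ in {ω | (t : WithTop ℕ) < τ ω} ∩ {ω | ω t ∈ A}, ε ∂(pathMeasure P z) := by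
        rw [setLIntegral_const]
    _ ≤ ∫⁻ ω in {ω | (t : WithTop ℕ) < τ ω} ∩ {ω | ω t ∈ A}, P (ω t) S ∂(pathMeasure P z) :=
        setLIntegral_mono' ((measurableSet_of_piLE hlt).inter (measurable_pi_apply t hA))
          fun ω hω => hε _ hω.2
    _ ≤ ∫⁻ ω in {ω | (t : WithTop ℕ) < τ ω}, P (ω t) S ∂(pathMeasure P z) :=
        lintegral_mono_set inter_subset_left
    _ = ∫⁻ ω in {ω | (t : WithTop ℕ) < τ ω},
          ((fun ω : ℕ → Z => ω (t + 1)) ⁻¹' S).indicator 1 ω ∂(pathMeasure P z) := by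
        have h := setLIntegral_eval_succ (P := P) (z := z) (measurable_one.indicator hS) hlt
        simp only [lintegral_indicator_one hS] at h
        exact h.symm
    _ = pathMeasure P z ((fun ω => ω (t + 1)) ⁻¹' S ∩ {ω | (t : WithTop ℕ) < τ ω}) := by
        rw [lintegral_indicator_one hnext, Measure.restrict_apply hnext]
    _ ≤ pathMeasure P z {ω | τ ω = (t + 1 : ℕ)} := by
        refine measure_mono fun ω hω => le_antisymm
          (hittingAfter_le_of_mem (Nat.zero_le _) hω.1) ?_
        exact WithTop.succ_coe.ge.trans (Order.succ_le_of_lt hω.2)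

lemma tsum_measure_hittingAfter_eq_succ_le_one (hS : MeasurableSet S) :
    ∑' t : ℕ, pathMeasure P z
      {ω | hittingAfter (fun (t : ℕ) (ω : ℕ → Z) => ω t) S 0 ω = (t + 1 : ℕ)} ≤ 1 := by
  refine (tsum_measure_le_measure_univ (fun t => ?_) fun s t hst => ?_).trans prob_le_one
  · exact (measurableSet_of_piLE
      ((isStoppingTime_hittingAfter_eval hS).measurableSet_eq (t + 1))).nullMeasurableSet
  · refine (disjoint_left.2 fun ω hs ht => hst ?_).aedisjoint
    exact Nat.succ_injective (WithTop.coe_injective ((Eq.symm hs).trans ht))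

/-- If `p = ℙ_z(τ = ∞)` were positive, then in every period the process would, with probability at
least `p / 2`, be in `A` without having stopped, so that `ℙ_z(τ = t + 1) ≥ ε p / 2` for all `t`. -/
lemma isFiniteStoppingTime_hittingAfter_of_tight (hS : MeasurableSet S)
    (h : ∀ q : ℝ≥0∞, q ≠ 0 → ∃ A, MeasurableSet A ∧
      (∀ t, pathMeasure P z {ω | ω t ∉ A} ≤ q) ∧ ∃ ε : ℝ≥0∞, ε ≠ 0 ∧ ∀ y ∈ A, ε ≤ P y S) :
    IsFiniteStoppingTime P z (hittingAfter (fun t ω => ω t) S 0) := by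
  refine ⟨isStoppingTime_hittingAfter_eval hS, ?_⟩
  set τ := hittingAfter (fun (t : ℕ) (ω : ℕ → Z) => ω t) S 0
  rw [ae_iff]
  simp only [ne_eq, not_not]
  set p := pathMeasure P z {ω | τ ω = ⊤}
  by_contra hp
  obtain ⟨A, hA, htight, ε, hε, hεA⟩ := h (p / 2) (ENNReal.half_pos hp).ne'
  have hhalf (t : ℕ) :
      p / 2 ≤ pathMeasure P z ({ω | (t : WithTop ℕ) < τ ω} ∩ {ω | ω t ∈ A}) := by
    have hcover : {ω | τ ω = ⊤} ⊆
        ({ω | (t : WithTop ℕ) < τ ω} ∩ {ω | ω t ∈ A}) ∪ {ω | ω t ∉ A} := fun ω hω => by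
      have hlt : (t : WithTop ℕ) < τ ω := (WithTop.coe_lt_top t).trans_eq (Eq.symm hω)
      by_cases hωA : ω t ∈ A
      exacts [Or.inl ⟨hlt, hωA⟩, Or.inr hωA]
    rw [← ENNReal.sub_half (measure_ne_top _ _), tsub_le_iff_right]
    exact (measure_mono hcover).trans ((measure_union_le _ _).trans (by gcongr; exact htight t))
  have hstep (t : ℕ) : ε * (p / 2) ≤ pathMeasure P z {ω | τ ω = (t + 1 : ℕ)} :=
    (mul_le_mul_right (hhalf t) ε).trans
      (mul_measure_le_measure_hittingAfter_eq_succ hS hA hεA t)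
  have hdiverge : ∑' _ : ℕ, ε * (p / 2) = ⊤ :=
    ENNReal.tsum_const_eq_top_of_ne_zero (mul_ne_zero hε (ENNReal.half_pos hp).ne')
  exact ENNReal.one_ne_top (top_le_iff.1 (hdiverge.ge.trans ((ENNReal.tsum_le_tsum hstep).trans
    (tsum_measure_hittingAfter_eq_succ_le_one hS))))

variable {V : Z → ℝ≥0∞} {a b : ℝ≥0∞}

lemma lintegral_eval_le_of_affine_drift (hVm : Measurable V) (ha : a < 1)
    (hdrift : ∀ y, ∫⁻ x, V x ∂(P y) ≤ a * V y + b) (z : Z) (t : ℕ) :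
    ∫⁻ ω, V (ω t) ∂(pathMeasure P z) ≤ V z + b * (1 - a)⁻¹ := by
  induction t with
  | zero => exact (lintegral_eval_zero hVm).trans_le le_self_add
  | succ t ih =>
    have hgeom : a * (1 - a)⁻¹ + 1 = (1 - a)⁻¹ := by
      calc a * (1 - a)⁻¹ + 1 = a * (1 - a)⁻¹ + (1 - a) * (1 - a)⁻¹ := by
            rw [ENNReal.mul_inv_cancel (tsub_pos_of_lt ha).ne'
              (ENNReal.sub_ne_top ENNReal.one_ne_top)]
        _ = (1 - a)⁻¹ := by rw [← add_mul, add_tsub_cancel_of_le ha.le, one_mul]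
    calc ∫⁻ ω, V (ω (t + 1)) ∂(pathMeasure P z)
        = ∫⁻ ω, ∫⁻ y, V y ∂(P (ω t)) ∂(pathMeasure P z) := lintegral_eval_succ hVm
      _ ≤ ∫⁻ ω, (a * V (ω t) + b) ∂(pathMeasure P z) := lintegral_mono fun ω => hdrift (ω t)
      _ = a * ∫⁻ ω, V (ω t) ∂(pathMeasure P z) + b := by
          rw [lintegral_add_right _ measurable_const,
            lintegral_const_mul _ (by fun_prop), lintegral_const, measure_univ, mul_one]
      _ ≤ a * (V z + b * (1 - a)⁻¹) + b := by gcongr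
      _ = a * V z + b * (a * (1 - a)⁻¹ + 1) := by ring
      _ ≤ V z + b * (1 - a)⁻¹ := by
          rw [hgeom]
          gcongr
          exact mul_le_of_le_one_left' ha.le

lemma isFiniteStoppingTime_hittingAfter_of_affine_drift (hVm : Measurable V) (hVz : V z ≠ ⊤)
    (ha : a < 1) (hb : b ≠ ⊤) (hdrift : ∀ y, ∫⁻ x, V x ∂(P y) ≤ a * V y + b)
    (hS : MeasurableSet S)
    (hpos : ∀ R : ℝ≥0∞, R ≠ ⊤ → ∃ ε : ℝ≥0∞, ε ≠ 0 ∧ ∀ y, V y ≤ R → ε ≤ P y S) :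
    IsFiniteStoppingTime P z (hittingAfter (fun t ω => ω t) S 0) := by
  refine isFiniteStoppingTime_hittingAfter_of_tight hS fun q hq => ?_
  set D := V z + b * (1 - a)⁻¹ + 1
  have hD : D ≠ ⊤ := by
    have := ENNReal.inv_ne_top.2 (tsub_pos_of_lt ha).ne'
    finiteness
  have hD0 : D ≠ 0 := by simp [D]
  obtain ⟨ε, hε, hεS⟩ := hpos (D / q) (ENNReal.div_ne_top hD hq)
  refine ⟨{y | V y ≤ D / q}, measurableSet_le hVm measurable_const, fun t => ?_, ε, hε, hεS⟩
  rcases eq_or_ne q ⊤ with rfl | hq'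
  · exact le_top
  calc pathMeasure P z {ω | ω t ∉ {y | V y ≤ D / q}}
      ≤ pathMeasure P z {ω | D / q ≤ V (ω t)} :=
        measure_mono fun ω (hω : ¬ V (ω t) ≤ D / q) => le_of_not_ge hω
    _ ≤ (∫⁻ ω, V (ω t) ∂(pathMeasure P z)) / (D / q) :=
        meas_ge_le_lintegral_div (hVm.comp (measurable_pi_apply t)).aemeasurable
          (ENNReal.div_ne_zero.2 ⟨hD0, hq'⟩) (ENNReal.div_ne_top hD hq)
    _ ≤ D / (D / q) := by
        gcongr
        exact (lintegral_eval_le_of_affine_drift hVm ha hdrift z t).trans le_self_add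
    _ = q := ENNReal.div_div_cancel hD0 hD

end Recurrence

end OptStop

section ContinuationValue

variable {Y Z : Type} [MeasurableSpace Y] [MeasurableSpace Z]

/-- The continuation value (Jovanovic) operator of the stopping problem in which the state `z` is
drawn from `κ y`, stopping yields `r z`, and continuing yields `c (π z)` and a draw from
`κ (π z)`. -/
def contOp (κ : Kernel Y Z) (π : Z → Y) (β : ℝ) (r : Z → ℝ) (c ψ : Y → ℝ) (y : Y) : ℝ :=
  c y + β * ∫ z, max (r z) (ψ (π z)) ∂(κ y)

section Sign

variable {κ : Kernel Y Z} {π : Z → Y} {β : ℝ} {r : Z → ℝ} {c ψ : Y → ℝ}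

lemma flow_le_contOp (hβ : 0 ≤ β) (hr : ∀ z, 0 ≤ r z) (y : Y) : c y ≤ contOp κ π β r c ψ y := by
  rw [contOp, le_add_iff_nonneg_right]
  exact mul_nonneg hβ (integral_nonneg fun z => (hr z).trans (le_max_left _ _))

lemma contOp_le_flow (hβ : 0 ≤ β) (hr : ∀ z, r z ≤ 0)
    (hψ : ∀ y, ψ y ≤ 0) (y : Y) : contOp κ π β r c ψ y ≤ c y := by
  rw [contOp, add_le_iff_nonpos_right]
  exact mul_nonpos_of_nonneg_of_nonpos hβ
    (integral_nonpos fun z => max_le (hr z) (hψ (π z)))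

end Sign

/-- A drift weight `ℓ` under which the stopping problem of `contOp` is well behaved: the growth
`K` of `ℓ` is offset by the discount factor, and `c` and `y ↦ 𝔼_y |r|` are `ℓ`-bounded. The exit
payoff `r` itself need not be. -/
structure IsStoppingWeight (κ : Kernel Y Z) (π : Z → Y) (β : ℝ) (r : Z → ℝ) (c ℓ : Y → ℝ) (K : ℝ) :
    Prop extends IsDriftWeight κ π ℓ K where
  discount_nonneg : 0 ≤ β
  discount : β * K < 1
  exit_measurable : Measurable r
  exit_integrable : ∀ y, Integrable r (κ y)
  exit : MemWeighted ℓ fun y => ∫ z, |r z| ∂(κ y)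
  flow : MemWeighted ℓ c

namespace IsStoppingWeight

variable {κ : Kernel Y Z} {π : Z → Y} {β K : ℝ} {r : Z → ℝ} {c ℓ ψ φ : Y → ℝ}

lemma integrable_max (h : IsStoppingWeight κ π β r c ℓ K) (hψ : MemWeighted ℓ ψ) (y : Y) :
    Integrable (fun z => max (r z) (ψ (π z))) (κ y) :=
  (h.exit_integrable y).sup (h.integrable_of_memWeighted hψ y)

lemma memWeighted_contOp (h : IsStoppingWeight κ π β r c ℓ K) (hψ : MemWeighted ℓ ψ) :
    MemWeighted ℓ (contOp κ π β r c ψ) := by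
  have hmax : Measurable fun z => max (r z) (ψ (π z)) :=
    h.exit_measurable.max (hψ.1.comp h.measurable_proj)
  refine .of_abs_le h.pos
    (h.flow.1.add (hmax.stronglyMeasurable.integral_kernel.measurable.const_mul β))
    (B := weightedNorm ℓ c + β * (weightedNorm ℓ (fun y => ∫ z, |r z| ∂(κ y)) +
      weightedNorm ℓ ψ * K)) fun y => ?_
  have hr := (le_abs_self _).trans (h.exit.abs_le h.pos y)
  have hint : |∫ z, max (r z) (ψ (π z)) ∂(κ y)| ≤ ∫ z, |r z| ∂(κ y) + ∫ z, |ψ (π z)| ∂(κ y) := by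
    have hψi := (h.integrable_of_memWeighted hψ y).abs
    rw [← integral_add (h.exit_integrable y).abs hψi]
    exact abs_integral_le_integral_abs.trans (integral_mono (h.integrable_max hψ y).abs
      ((h.exit_integrable y).abs.add hψi) fun z =>
        abs_max_le_max_abs_abs.trans (max_le_add_of_nonneg (abs_nonneg _) (abs_nonneg _)))
  calc |contOp κ π β r c ψ y|
      ≤ |c y| + β * |∫ z, max (r z) (ψ (π z)) ∂(κ y)| :=
        (abs_add_le _ _).trans_eq (by rw [abs_mul, abs_of_nonneg h.discount_nonneg])
    _ ≤ weightedNorm ℓ c * ℓ y + β * (weightedNorm ℓ (fun y => ∫ z, |r z| ∂(κ y)) * ℓ y +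
          weightedNorm ℓ ψ * K * ℓ y) :=
        add_le_add (h.flow.abs_le h.pos y) (mul_le_mul_of_nonneg_left
          (hint.trans (add_le_add hr (h.integral_abs_le hψ y))) h.discount_nonneg)
    _ = _ := by ring

lemma abs_contOp_sub_le (h : IsStoppingWeight κ π β r c ℓ K) (hψ : MemWeighted ℓ ψ)
    (hφ : MemWeighted ℓ φ) (y : Y) :
    |contOp κ π β r c ψ y - contOp κ π β r c φ y| ≤ β * K * weightedNorm ℓ (ψ - φ) * ℓ y := by
  have hψi := h.integrable_max hψ y
  have hφi := h.integrable_max hφ y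
  have hsub := hψ.sub hφ h.pos
  calc |contOp κ π β r c ψ y - contOp κ π β r c φ y|
      = β * |∫ z, (max (r z) (ψ (π z)) - max (r z) (φ (π z))) ∂(κ y)| := by
        rw [integral_sub hψi hφi, contOp, contOp, add_sub_add_left_eq_sub, ← mul_sub, abs_mul,
          abs_of_nonneg h.discount_nonneg]
    _ ≤ β * ∫ z, |(ψ - φ) (π z)| ∂(κ y) := by
        refine mul_le_mul_of_nonneg_left (abs_integral_le_integral_abs.trans
          (integral_mono (hψi.sub hφi).abs (h.integrable_of_memWeighted hsub y).abs
            fun z => ?_)) h.discount_nonneg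
        simp only [max_comm (r z)]
        exact abs_max_sub_max_le_abs (ψ (π z)) (φ (π z)) (r z)
    _ ≤ β * (weightedNorm ℓ (ψ - φ) * K * ℓ y) :=
        mul_le_mul_of_nonneg_left (h.integral_abs_le hsub y) h.discount_nonneg
    _ = _ := by ring

lemma isWeightedContraction (h : IsStoppingWeight κ π β r c ℓ K) :
    IsWeightedContraction ℓ (contOp κ π β r c) := by
  have hβK := mul_nonneg h.discount_nonneg h.growth_nonneg
  exact ⟨fun ψ => h.memWeighted_contOp, β * K, hβK, h.discount, fun ψ φ hψ hφ =>
    weightedNorm_le h.pos (mul_nonneg hβK (weightedNorm_nonneg h.pos))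
      (h.abs_contOp_sub_le hψ hφ)⟩

lemma fixed_le_flow (h : IsStoppingWeight κ π β r c ℓ K) (hψ : MemWeighted ℓ ψ)
    (hfix : contOp κ π β r c ψ = ψ) (hr : ∀ z, r z ≤ 0) (hc : ∀ y, c y ≤ 0) (y : Y) :
    ψ y ≤ c y := by
  have hψ0 : ψ ∈ Iic 0 := h.isWeightedContraction.fixed_mem_of_isClosed h.pos hψ hfix isClosed_Iic
    (fun φ _ hφ y => (contOp_le_flow h.discount_nonneg hr hφ y).trans (hc y)) .zero self_mem_Iic
  exact (congrFun hfix y).ge.trans (contOp_le_flow h.discount_nonneg hr hψ0 y)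

lemma isDriftWeight_abs_exit_add (h : IsStoppingWeight κ π β r c ℓ K) {D K' : ℝ} (hD : 0 < D)
    (hK' : 0 ≤ K') (hDK : weightedNorm ℓ (fun y => ∫ z, |r z| ∂(κ y)) + K * D ≤ K' * D) :
    IsDriftWeight (κ.comap π h.measurable_proj) id (fun z => |r z| + D * ℓ (π z)) K' where
  measurable_proj := measurable_id
  measurable := h.exit_measurable.abs.add ((h.measurable.comp h.measurable_proj).const_mul D)
  pos z := add_pos_of_nonneg_of_pos (abs_nonneg _) (mul_pos hD (h.pos _))
  growth_nonneg := hK'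
  integrable z := (h.exit_integrable (π z)).abs.add ((h.integrable (π z)).const_mul D)
  drift z := by
    set C := weightedNorm ℓ fun y => ∫ z, |r z| ∂(κ y)
    calc ∫ x, |r x| + D * ℓ (π x) ∂(κ (π z))
        = ∫ x, |r x| ∂(κ (π z)) + D * ∫ x, ℓ (π x) ∂(κ (π z)) := by
          rw [integral_add (h.exit_integrable _).abs ((h.integrable _).const_mul D),
            integral_const_mul]
      _ ≤ C * ℓ (π z) + D * (K * ℓ (π z)) :=
          add_le_add ((le_abs_self _).trans (h.exit.abs_le h.pos (π z)))
            (mul_le_mul_of_nonneg_left (h.drift (π z)) hD.le)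
      _ = (C + K * D) * ℓ (π z) := by ring
      _ ≤ K' * D * ℓ (π z) := mul_le_mul_of_nonneg_right hDK (h.pos _).le
      _ ≤ K' * (|r z| + D * ℓ (π z)) := by
          rw [mul_assoc]
          gcongr
          exact le_add_of_nonneg_left (abs_nonneg _)

lemma exists_stateWeight (h : IsStoppingWeight κ π β r c ℓ K) :
    ∃ V K', β * K' < 1 ∧ IsDriftWeight (κ.comap π h.measurable_proj) id V K' ∧ MemWeighted V r ∧
      ∀ f, MemWeighted ℓ f → MemWeighted V fun z => f (π z) := by
  obtain ⟨K', hKK', hdiscount⟩ : ∃ K', K < K' ∧ β * K' < 1 := by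
    have hnear := ((continuous_const_mul β).tendsto K).eventually_lt_const h.discount
    have hright : ∀ᶠ x in nhdsWithin K (Ioi K), K < x := self_mem_nhdsWithin
    exact (hright.and (nhdsWithin_le_nhds hnear)).exists
  set C := weightedNorm ℓ fun y => ∫ z, |r z| ∂(κ y)
  have hC : 0 ≤ C := weightedNorm_nonneg h.pos
  have hgap : 0 < K' - K := sub_pos.2 hKK'
  set D := C / (K' - K) + 1
  have hD : 0 < D := by positivity
  have hCD : C + K * D ≤ K' * D := by
    have : C ≤ (K' - K) * D := by
      rw [mul_add, mul_div_cancel₀ _ hgap.ne']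
      linarith
    linarith
  have hV := h.isDriftWeight_abs_exit_add hD (h.growth_nonneg.trans hKK'.le) hCD
  refine ⟨fun z => |r z| + D * ℓ (π z), K', hdiscount, hV,
    .of_abs_le hV.pos h.exit_measurable (B := 1) fun z => ?_,
    fun f hf => .of_abs_le hV.pos (hf.1.comp h.measurable_proj) (B := weightedNorm ℓ f / D)
      fun z => ?_⟩
  · have := h.pos (π z)
    rw [one_mul]
    exact le_add_of_nonneg_right (by positivity)
  · have hf0 : 0 ≤ weightedNorm ℓ f := weightedNorm_nonneg h.pos
    calc |f (π z)| ≤ weightedNorm ℓ f / D * (D * ℓ (π z)) := by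
          rw [← mul_assoc, div_mul_cancel₀ _ hD.ne']
          exact hf.abs_le h.pos (π z)
      _ ≤ weightedNorm ℓ f / D * (|r z| + D * ℓ (π z)) := by
          gcongr
          exact le_add_of_nonneg_left (abs_nonneg _)

section Solution

variable [IsMarkovKernel κ]

lemma valueWellDefined (h : IsStoppingWeight κ π β r c ℓ K) :
    OptStop.ValueWellDefined (κ.comap π h.measurable_proj) β r (fun z => c (π z)) := by
  obtain ⟨ψ, hψ, hfix⟩ := h.isWeightedContraction.exists_fixed h.pos
  obtain ⟨V, K', hβK', hV, hr, hlift⟩ := h.exists_stateWeight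
  exact OptStop.valueWellDefined_of_excessive hV h.discount_nonneg hβK' (hlift c h.flow) hr
    (hr.max (hlift ψ hψ) hV.pos) (fun z => le_max_left _ _)
    fun z => (congrFun hfix (π z)).le.trans (le_max_right _ _)

lemma value_eq_and_isOptimalPolicy (h : IsStoppingWeight κ π β r c ℓ K) (hψ : MemWeighted ℓ ψ)
    (hfix : contOp κ π β r c ψ = ψ)
    (hS : ∀ z, OptStop.IsFiniteStoppingTime (κ.comap π h.measurable_proj) z
      (hittingAfter (fun t ω => ω t) {z | ψ (π z) ≤ r z} 0)) :
    OptStop.value (κ.comap π h.measurable_proj) β r (fun z => c (π z)) =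
        (fun z => max (r z) (ψ (π z))) ∧
      OptStop.IsOptimalPolicy (κ.comap π h.measurable_proj) β r (fun z => c (π z))
        {z | ψ (π z) ≤ r z} := by
  obtain ⟨V, K', hβK', hV, hr, hlift⟩ := h.exists_stateWeight
  have hcont (z : Z) := congrFun hfix (π z)
  exact OptStop.value_eq_and_isOptimalPolicy hV h.discount_nonneg hβK' (hlift c h.flow) hr
    (hr.max (hlift ψ hψ) hV.pos) (fun z => le_max_left _ _)
    (fun z => (hcont z).le.trans (le_max_right _ _)) hS
    (fun z hz => (max_eq_left hz).symm)
    fun z hz => (hcont z).trans (max_eq_right (le_of_not_ge hz)).symm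

end Solution

end IsStoppingWeight

end ContinuationValue

section LogNormal

lemma integrable_rpow_logNormal (μ : ℝ) (γ : ℝ≥0) (p : ℝ) :
    Integrable (fun x : PosReal => (x : ℝ) ^ p) (logNormal μ γ) := by
  have hm : Measurable fun x : PosReal => (x : ℝ) ^ p := by fun_prop
  rw [logNormal, integrable_map_measure hm.aestronglyMeasurable measurable_posExp.aemeasurable]
  simpa only [Function.comp_def, ← Real.exp_mul, mul_comm] using
    integrable_exp_mul_gaussianReal (μ := μ) (v := γ) p

lemma integral_rpow_logNormal (μ : ℝ) (γ : ℝ≥0) (p : ℝ) :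
    ∫ x : PosReal, (x : ℝ) ^ p ∂(logNormal μ γ) = Real.exp (μ * p + γ * p ^ 2 / 2) := by
  have hm : Measurable fun x : PosReal => (x : ℝ) ^ p := by fun_prop
  rw [logNormal, integral_map measurable_posExp.aemeasurable hm.aestronglyMeasurable,
    ← congrFun (mgf_fun_id_gaussianReal (μ := μ) (v := γ)) p, mgf]
  simp only [← Real.exp_mul, mul_comm]

end LogNormal

section Rpow

lemma rpow_add_rpow_neg_le {x p q : ℝ} (hx : 0 < x) (h : |q| ≤ |p|) :
    x ^ q + x ^ (-q) ≤ x ^ p + x ^ (-p) := by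
  have hcosh (t : ℝ) : x ^ t + x ^ (-t) = 2 * Real.cosh (Real.log x * t) := by
    rw [Real.rpow_def_of_pos hx, Real.rpow_def_of_pos hx, Real.cosh_eq, mul_neg]
    ring
  rw [hcosh, hcosh]
  refine mul_le_mul_of_nonneg_left (Real.cosh_le_cosh.2 ?_) zero_le_two
  rw [abs_mul, abs_mul]
  gcongr

lemma add_rpow_le_rpow_add_rpow {x y p : ℝ} (hx : 0 < x) (hy : 0 < y) (hp : p ≤ 1) :
    (x + y) ^ p ≤ x ^ p + y ^ p := by
  rcases le_or_gt 0 p with h | h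
  · exact Real.rpow_add_le_add_rpow hx.le hy.le h hp
  · calc (x + y) ^ p ≤ x ^ p := Real.rpow_le_rpow_of_nonpos hx (by linarith) h.le
      _ ≤ x ^ p + y ^ p := le_add_of_nonneg_right (Real.rpow_nonneg hy.le p)

end Rpow

namespace JobSearch

variable (M : JobSearch)

section Transition

lemma measurable_next_right (θ : PosReal) : Measurable (M.next θ) :=
  M.measurable_next.comp measurable_prodMk_left

lemma integrable_thetaKernel_iff {f : PosReal × PosReal → ℝ} (hf : Measurable f) (θ : PosReal) :
    Integrable f (M.thetaKernel θ) ↔ Integrable (fun s => f (M.next θ s)) M.shockLaw :=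
  integrable_map_measure hf.aestronglyMeasurable (M.measurable_next_right θ).aemeasurable

lemma integral_thetaKernel {f : PosReal × PosReal → ℝ} (hf : Measurable f) (θ : PosReal) :
    ∫ z, f z ∂(M.thetaKernel θ) = ∫ s, f (M.next θ s) ∂M.shockLaw :=
  integral_map (M.measurable_next_right θ).aemeasurable hf.aestronglyMeasurable

lemma integrable_shock_rpow (p q t : ℝ) :
    Integrable (fun s : PosReal × PosReal × PosReal =>
      (s.1 : ℝ) ^ p * ((s.2.1 : ℝ) ^ q * (s.2.2 : ℝ) ^ t)) M.shockLaw :=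
  (integrable_rpow_logNormal _ _ p).mul_prod
    ((integrable_rpow_logNormal _ _ q).mul_prod (integrable_rpow_logNormal _ _ t))

lemma nextTheta_rpow (θ u : PosReal) (p : ℝ) :
    (M.nextTheta θ u : ℝ) ^ p = (θ : ℝ) ^ (p * M.ρ) * (u : ℝ) ^ p := by
  rw [nextTheta, Real.mul_rpow (Real.rpow_nonneg θ.2.le _) u.2.le, ← Real.rpow_mul θ.2.le,
    mul_comm p]

lemma integrable_theta_rpow (θ : PosReal) (p : ℝ) :
    Integrable (fun z : PosReal × PosReal => (z.2 : ℝ) ^ p) (M.thetaKernel θ) := by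
  rw [M.integrable_thetaKernel_iff (by fun_prop)]
  simpa [next, M.nextTheta_rpow] using
    (M.integrable_shock_rpow p 0 0).const_mul ((θ : ℝ) ^ (p * M.ρ))

lemma integral_theta_rpow (θ : PosReal) (p : ℝ) :
    ∫ z, (z.2 : ℝ) ^ p ∂(M.thetaKernel θ) =
      Real.exp (M.γu * p ^ 2 / 2) * (θ : ℝ) ^ (p * M.ρ) := by
  rw [M.integral_thetaKernel (by fun_prop)]
  simp only [next, M.nextTheta_rpow]
  have hu : ∫ s, (s.1 : ℝ) ^ p ∂M.shockLaw = Real.exp (M.γu * p ^ 2 / 2) := by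
    refine (integral_fun_fst fun u : PosReal => (u : ℝ) ^ p).trans ?_
    simp [integral_rpow_logNormal]
  rw [integral_const_mul, hu, mul_comm]

end Transition

section ExitPayoff

variable {M}

lemma measurable_r (M : JobSearch) : Measurable M.r := by
  unfold r crra
  split_ifs <;> fun_prop

lemma measurable_exit (M : JobSearch) : Measurable fun z : PosReal × PosReal => M.r z.1 :=
  M.measurable_r.comp measurable_fst

lemma r_eq (hδ1 : M.δ ≠ 1) (w : PosReal) :
    M.r w = (w : ℝ) ^ (1 - M.δ) / ((1 - M.β) * (1 - M.δ)) := by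
  rw [r, crra, if_neg hδ1, div_div, mul_comm]

lemma abs_r_eq (hβ1 : M.β < 1) (hδ1 : M.δ ≠ 1) (w : PosReal) :
    |M.r w| = (w : ℝ) ^ (1 - M.δ) / ((1 - M.β) * |1 - M.δ|) := by
  rw [r_eq hδ1, abs_div, abs_mul, abs_of_pos (Real.rpow_pos_of_pos w.2 _),
    abs_of_pos (sub_pos.2 hβ1)]

lemma abs_r_next_le (hβ1 : M.β < 1) (hδ0 : 0 ≤ M.δ) (hδ1 : M.δ ≠ 1) (θ : PosReal)
    (s : PosReal × PosReal × PosReal) :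
    |M.r (M.next θ s).1| ≤ ((s.2.2 : ℝ) ^ (1 - M.δ) + (θ : ℝ) ^ ((1 - M.δ) * M.ρ) *
      ((s.1 : ℝ) ^ (1 - M.δ) * (s.2.1 : ℝ) ^ (1 - M.δ))) / ((1 - M.β) * |1 - M.δ|) := by
  rw [abs_r_eq hβ1 hδ1]
  refine div_le_div_of_nonneg_right ?_ (mul_nonneg (sub_nonneg.2 hβ1.le) (abs_nonneg _))
  refine (add_rpow_le_rpow_add_rpow s.2.2.2 (mul_pos (M.nextTheta θ s.1).2 s.2.1.2)
    (by linarith)).trans_eq ?_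
  rw [Real.mul_rpow (M.nextTheta θ s.1).2.le s.2.1.2.le, nextTheta_rpow, mul_assoc]

lemma exists_integral_abs_exit_le (hβ1 : M.β < 1) (hδ0 : 0 ≤ M.δ) (hδ1 : M.δ ≠ 1) :
    ∃ A B : ℝ, 0 ≤ A ∧ 0 ≤ B ∧ ∀ θ,
      Integrable (fun z : PosReal × PosReal => M.r z.1) (M.thetaKernel θ) ∧
      ∫ z, |M.r z.1| ∂(M.thetaKernel θ) ≤ A + B * (θ : ℝ) ^ ((1 - M.δ) * M.ρ) := by
  set R := (1 - M.β) * |1 - M.δ|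
  have hR : 0 ≤ R := mul_nonneg (sub_nonneg.2 hβ1.le) (abs_nonneg _)
  set f : PosReal × PosReal × PosReal → ℝ := fun s => (s.2.2 : ℝ) ^ (1 - M.δ)
  set g : PosReal × PosReal × PosReal → ℝ :=
    fun s => (s.1 : ℝ) ^ (1 - M.δ) * (s.2.1 : ℝ) ^ (1 - M.δ)
  have hf : Integrable f M.shockLaw := by simpa using M.integrable_shock_rpow 0 0 (1 - M.δ)
  have hg : Integrable g M.shockLaw := by
    simpa using M.integrable_shock_rpow (1 - M.δ) (1 - M.δ) 0
  have hf0 (s) : 0 ≤ f s := Real.rpow_nonneg s.2.2.2.le _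
  have hg0 (s) : 0 ≤ g s :=
    mul_nonneg (Real.rpow_nonneg s.1.2.le _) (Real.rpow_nonneg s.2.1.2.le _)
  have hmajorant (θ : PosReal) : Integrable
      (fun s => (f s + (θ : ℝ) ^ ((1 - M.δ) * M.ρ) * g s) / R) M.shockLaw :=
    (hf.add (hg.const_mul _)).div_const R
  have hexit (θ : PosReal) : Integrable (fun s => M.r (M.next θ s).1) M.shockLaw :=
    (hmajorant θ).mono' (M.measurable_exit.comp (M.measurable_next_right θ)).aestronglyMeasurable
      (ae_of_all _ (abs_r_next_le hβ1 hδ0 hδ1 θ))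
  refine ⟨(∫ s, f s ∂M.shockLaw) / R, (∫ s, g s ∂M.shockLaw) / R,
    div_nonneg (integral_nonneg hf0) hR, div_nonneg (integral_nonneg hg0) hR, fun θ =>
    ⟨(M.integrable_thetaKernel_iff M.measurable_exit θ).2 (hexit θ), ?_⟩⟩
  calc ∫ z, |M.r z.1| ∂(M.thetaKernel θ)
      = ∫ s, |M.r (M.next θ s).1| ∂M.shockLaw := M.integral_thetaKernel M.measurable_exit.abs θ
    _ ≤ ∫ s, (f s + (θ : ℝ) ^ ((1 - M.δ) * M.ρ) * g s) / R ∂M.shockLaw :=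
        integral_mono (hexit θ).abs (hmajorant θ) (abs_r_next_le hβ1 hδ0 hδ1 θ)
    _ = _ := by
        rw [integral_div, integral_add hf (hg.const_mul _), integral_const_mul]
        ring

end ExitPayoff

section AbsExit

lemma stateLaw_succ_eq_comp_thetaKernel (k : ℕ) :
    M.stateLaw (k + 1) = (M.stateLaw k).comap Prod.snd measurable_snd ∘ₖ M.thetaKernel := by
  induction k with
  | zero => rfl
  | succ k ih =>
    conv_lhs => rw [stateLaw, ih, ← Kernel.comp_assoc]
    rfl

lemma absExit_nonneg (k : ℕ) (θ : PosReal) : 0 ≤ M.absExit k θ :=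
  integral_nonneg fun _ => abs_nonneg _

lemma measurable_absExit (k : ℕ) : Measurable (M.absExit k) :=
  (M.measurable_exit.abs.stronglyMeasurable.integral_kernel (κ := M.stateLaw k)).measurable

lemma integrable_exit_stateLaw_succ_iff {k : ℕ}
    (hk : ∀ θ, Integrable (fun z : PosReal × PosReal => M.r z.1) (M.stateLaw k θ)) (θ : PosReal) :
    Integrable (fun z : PosReal × PosReal => M.r z.1) (M.stateLaw (k + 1) θ) ↔
      Integrable (fun z : PosReal × PosReal => M.absExit k z.2) (M.thetaKernel θ) := by
  rw [stateLaw_succ_eq_comp_thetaKernel,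
    integrable_comp_iff M.measurable_exit.aestronglyMeasurable]
  exact and_iff_right (ae_of_all _ fun z => hk z.2)

lemma integral_absExit_eq_of_integrable {k : ℕ} {θ : PosReal}
    (h : Integrable (fun z : PosReal × PosReal => M.r z.1) (M.stateLaw (k + 1) θ)) :
    ∫ z, M.absExit k z.2 ∂(M.thetaKernel θ) = M.absExit (k + 1) θ := by
  have habs := h.abs
  rw [stateLaw_succ_eq_comp_thetaKernel] at habs
  rw [absExit, stateLaw_succ_eq_comp_thetaKernel, Kernel.integral_comp habs]
  rfl

variable {M}

lemma exists_absExit_le (hβ1 : M.β < 1) (hδ0 : 0 ≤ M.δ) (hδ1 : M.δ ≠ 1) (k : ℕ) :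
    ∃ A B : ℝ, 0 ≤ A ∧ 0 ≤ B ∧ ∀ θ,
      Integrable (fun z : PosReal × PosReal => M.r z.1) (M.stateLaw k θ) ∧
      M.absExit k θ ≤ A + B * (θ : ℝ) ^ ((1 - M.δ) * M.ρ ^ (k + 1)) := by
  induction k with
  | zero => simpa [absExit, stateLaw] using exists_integral_abs_exit_le hβ1 hδ0 hδ1
  | succ k ih =>
    obtain ⟨A, B, hA, hB, hk⟩ := ih
    set p := (1 - M.δ) * M.ρ ^ (k + 1)
    have hmajorant (θ : PosReal) :
        Integrable (fun z : PosReal × PosReal => A + B * (z.2 : ℝ) ^ p) (M.thetaKernel θ) :=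
      (integrable_const A).add ((M.integrable_theta_rpow θ p).const_mul B)
    have habs (θ : PosReal) :
        Integrable (fun z : PosReal × PosReal => M.absExit k z.2) (M.thetaKernel θ) :=
      (hmajorant θ).mono' ((M.measurable_absExit k).comp measurable_snd).aestronglyMeasurable
        (ae_of_all _ fun z => by
          rw [Real.norm_of_nonneg (M.absExit_nonneg k z.2)]
          exact (hk z.2).2)
    have hexit (θ : PosReal) :=
      (M.integrable_exit_stateLaw_succ_iff (fun θ => (hk θ).1) θ).2 (habs θ)
    refine ⟨A, B * Real.exp (M.γu * p ^ 2 / 2), hA, by positivity, fun θ => ⟨hexit θ, ?_⟩⟩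
    calc M.absExit (k + 1) θ = ∫ z, M.absExit k z.2 ∂(M.thetaKernel θ) :=
          (M.integral_absExit_eq_of_integrable (hexit θ)).symm
      _ ≤ ∫ z, A + B * (z.2 : ℝ) ^ p ∂(M.thetaKernel θ) :=
          integral_mono (habs θ) (hmajorant θ) fun z => (hk z.2).2
      _ = A + B * (Real.exp (M.γu * p ^ 2 / 2) * (θ : ℝ) ^ (p * M.ρ)) := by
          rw [integral_add (integrable_const A) ((M.integrable_theta_rpow θ p).const_mul B),
            integral_const_mul, integral_theta_rpow]
          simp
      _ = _ := by rw [mul_assoc B, pow_succ M.ρ (k + 1), ← mul_assoc (1 - M.δ)]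

lemma integrable_exit_stateLaw (hβ1 : M.β < 1) (hδ0 : 0 ≤ M.δ) (hδ1 : M.δ ≠ 1) (k : ℕ)
    (θ : PosReal) : Integrable (fun z : PosReal × PosReal => M.r z.1) (M.stateLaw k θ) := by
  obtain ⟨A, B, -, -, h⟩ := exists_absExit_le hβ1 hδ0 hδ1 k
  exact (h θ).1

lemma integrable_absExit (hβ1 : M.β < 1) (hδ0 : 0 ≤ M.δ) (hδ1 : M.δ ≠ 1) (k : ℕ) (θ : PosReal) :
    Integrable (fun z : PosReal × PosReal => M.absExit k z.2) (M.thetaKernel θ) :=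
  (M.integrable_exit_stateLaw_succ_iff (integrable_exit_stateLaw hβ1 hδ0 hδ1 k) θ).1
    (integrable_exit_stateLaw hβ1 hδ0 hδ1 (k + 1) θ)

lemma integral_absExit (hβ1 : M.β < 1) (hδ0 : 0 ≤ M.δ) (hδ1 : M.δ ≠ 1) (k : ℕ) (θ : PosReal) :
    ∫ z, M.absExit k z.2 ∂(M.thetaKernel θ) = M.absExit (k + 1) θ :=
  M.integral_absExit_eq_of_integrable (integrable_exit_stateLaw hβ1 hδ0 hδ1 (k + 1) θ)

end AbsExit

section Growth

lemma measurable_g (n : ℕ) : Measurable (M.g n) := by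
  unfold g
  fun_prop

lemma g_pos (n : ℕ) (θ : PosReal) : 0 < M.g n θ :=
  add_pos (Real.rpow_pos_of_pos θ.2 _) (Real.rpow_pos_of_pos θ.2 _)

lemma one_le_m (n : ℕ) : 1 ≤ M.m n := by
  rw [m, Real.one_le_exp_iff, pow_mul']
  positivity

lemma integrable_g (n : ℕ) (θ : PosReal) :
    Integrable (fun z : PosReal × PosReal => M.g n z.2) (M.thetaKernel θ) :=
  (M.integrable_theta_rpow θ _).add (M.integrable_theta_rpow θ _)

variable {M}

lemma rpow_le_g {n : ℕ} {q : ℝ} (hq : |q| ≤ |(1 - M.δ) * M.ρ ^ n|) (θ : PosReal) :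
    (θ : ℝ) ^ q ≤ M.g n θ :=
  (le_add_of_nonneg_right (Real.rpow_nonneg θ.2.le _)).trans (rpow_add_rpow_neg_le θ.2 hq)

lemma integral_g_le (hρ : |M.ρ| ≤ 1) (n : ℕ) (θ : PosReal) :
    ∫ z, M.g n z.2 ∂(M.thetaKernel θ) ≤ M.m n * M.g n θ := by
  set p := (1 - M.δ) * M.ρ ^ n with hp
  have hm : Real.exp (M.γu * p ^ 2 / 2) ≤ M.m n := by
    have hsq : M.ρ ^ (2 * n) * ((1 - M.δ) ^ 2 * (M.γu : ℝ)) = M.γu * p ^ 2 := by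
      rw [hp, pow_mul']
      ring
    rw [m, Real.exp_le_exp, hsq]
    exact half_le_self (by positivity)
  have hg : (θ : ℝ) ^ (p * M.ρ) + (θ : ℝ) ^ (-(p * M.ρ)) ≤ M.g n θ := by
    refine rpow_add_rpow_neg_le θ.2 ?_
    rw [abs_mul]
    exact mul_le_of_le_one_right (abs_nonneg _) hρ
  calc ∫ z, M.g n z.2 ∂(M.thetaKernel θ)
      = Real.exp (M.γu * p ^ 2 / 2) * ((θ : ℝ) ^ (p * M.ρ) + (θ : ℝ) ^ (-(p * M.ρ))) := by
        unfold g
        rw [integral_add (M.integrable_theta_rpow θ _) (M.integrable_theta_rpow θ _),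
          integral_theta_rpow, integral_theta_rpow, ← hp, neg_sq, neg_mul]
        ring
    _ ≤ M.m n * M.g n θ := mul_le_mul hm hg
        (add_nonneg (Real.rpow_nonneg θ.2.le _) (Real.rpow_nonneg θ.2.le _))
        ((Real.exp_pos _).le.trans hm)

lemma exists_mul_m_lt_one (hβ1 : M.β < 1) (hρ : |M.ρ| < 1) : ∃ n, M.β * M.m n < 1 := by
  have hpow : Filter.Tendsto (fun n : ℕ => M.ρ ^ (2 * n)) Filter.atTop (nhds 0) := by
    simp only [pow_mul]
    exact tendsto_pow_atTop_nhds_zero_of_lt_one (sq_nonneg _) ((sq_lt_one_iff_abs_lt_one _).2 hρ)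
  have hm : Filter.Tendsto (fun n => M.β * M.m n) Filter.atTop (nhds M.β) := by
    simpa [m] using ((Real.continuous_exp.tendsto _).comp
      (hpow.mul_const ((1 - M.δ) ^ 2 * (M.γu : ℝ)))).const_mul M.β
  exact (hm.eventually_lt_const hβ1).exists

end Growth

section Admissible

variable {M} {n : ℕ} {a b m' d' : ℝ}

lemma measurable_ell (M : JobSearch) (n : ℕ) (a b m' d' : ℝ) :
    Measurable (M.ell n a b m' d') := by
  have := M.measurable_absExit
  have := M.measurable_g n
  unfold ell
  fun_prop

lemma integral_ell (hβ1 : M.β < 1) (hδ0 : 0 ≤ M.δ) (hδ1 : M.δ ≠ 1) (n : ℕ) (a b m' d' : ℝ)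
    (θ : PosReal) :
    Integrable (fun z : PosReal × PosReal => M.ell n a b m' d' z.2) (M.thetaKernel θ) ∧
      ∫ z, M.ell n a b m' d' z.2 ∂(M.thetaKernel θ) =
        m' * ((∑ k ∈ Finset.range (n - 1), M.absExit (k + 1) θ) + n * |M.c₀|) +
          (a * ∫ z, M.g n z.2 ∂(M.thetaKernel θ) + b) + d' := by
  have habs (k : ℕ) := integrable_absExit hβ1 hδ0 hδ1 k θ
  have hsum : Integrable (fun z : PosReal × PosReal =>
      ∑ k ∈ Finset.range (n - 1), M.absExit k z.2) (M.thetaKernel θ) :=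
    integrable_finsetSum _ fun k _ => habs k
  have hhead : Integrable (fun z : PosReal × PosReal =>
      m' * ((∑ k ∈ Finset.range (n - 1), M.absExit k z.2) + n * |M.c₀|)) (M.thetaKernel θ) :=
    (hsum.add (integrable_const _)).const_mul m'
  have hga := (M.integrable_g n θ).const_mul a
  have htail : Integrable (fun z : PosReal × PosReal => a * M.g n z.2 + b) (M.thetaKernel θ) :=
    hga.add (integrable_const b)
  have hcore : Integrable (fun z : PosReal × PosReal =>
      m' * ((∑ k ∈ Finset.range (n - 1), M.absExit k z.2) + n * |M.c₀|) + (a * M.g n z.2 + b))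
      (M.thetaKernel θ) := hhead.add htail
  refine ⟨hcore.add (integrable_const d'), ?_⟩
  unfold ell
  rw [integral_add hcore (integrable_const d'), integral_add hhead htail,
    integral_const_mul, integral_add hsum (integrable_const _), integral_add hga
    (integrable_const b), integral_finsetSum _ fun k _ => habs k]
  simp only [integral_absExit hβ1 hδ0 hδ1, integral_const_mul, integral_const, probReal_univ,
    one_smul]

lemma sum_absExit_nonneg (M : JobSearch) (n : ℕ) (θ : PosReal) :
    0 ≤ ∑ k ∈ Finset.range n, M.absExit k θ :=
  Finset.sum_nonneg fun k _ => M.absExit_nonneg k θ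

/-- `ℓ` is a weight for the job search problem: the conditions under which the continuation value
operator is a contraction of `b_ℓ` and its fixed point solves the stopping problem. -/
abbrev IsWeight (M : JobSearch) (ℓ : PosReal → ℝ) (K : ℝ) : Prop :=
  IsStoppingWeight M.thetaKernel Prod.snd M.β (fun z => M.r z.1) (fun _ => M.c₀) ℓ K

namespace IsAdmissible

lemma sum_absExit_succ_le (h : M.IsAdmissible n a b m' d') (θ : PosReal) :
    ∑ k ∈ Finset.range (n - 1), M.absExit (k + 1) θ ≤
      (∑ k ∈ Finset.range (n - 1), M.absExit k θ) + (a * M.g n θ + b) := by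
  rcases lt_or_ge n 2 with hn | hn
  · have := h.a_pos
    have := h.b_nonneg
    have := M.g_pos n θ
    simp only [Nat.sub_eq_zero_of_le (Nat.le_of_lt_succ hn), Finset.range_zero, Finset.sum_empty]
    positivity
  · obtain ⟨k, rfl⟩ := Nat.exists_eq_add_of_le' hn
    rw [Nat.add_sub_cancel_right (m := 1) (n := k + 1), Finset.sum_range_succ,
      Finset.sum_range_succ' fun j => M.absExit j θ]
    linarith [h.bound k rfl θ, M.absExit_nonneg 0 θ]

lemma le_ell (h : M.IsAdmissible n a b m' d') (θ : PosReal) :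
    d' ≤ M.ell n a b m' d' θ ∧ a * M.g n θ ≤ M.ell n a b m' d' θ ∧
      m' * ∑ k ∈ Finset.range (n - 1), M.absExit k θ ≤ M.ell n a b m' d' θ := by
  have hS := mul_nonneg h.m'_pos.le (M.sum_absExit_nonneg (n - 1) θ)
  have hN : 0 ≤ m' * (n * |M.c₀|) := mul_nonneg h.m'_pos.le (by positivity)
  have hG := mul_pos h.a_pos (M.g_pos n θ)
  have := h.b_nonneg
  have := h.d'_pos
  rw [ell, mul_add]
  refine ⟨?_, ?_, ?_⟩ <;> linarith

lemma ell_pos (h : M.IsAdmissible n a b m' d') (θ : PosReal) : 0 < M.ell n a b m' d' θ :=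
  h.d'_pos.trans_le (h.le_ell θ).1

lemma integral_ell_le (h : M.IsAdmissible n a b m' d') (hβ1 : M.β < 1) (hδ0 : 0 ≤ M.δ)
    (hδ1 : M.δ ≠ 1) (hρ : |M.ρ| ≤ 1) (θ : PosReal) :
    ∫ z, M.ell n a b m' d' z.2 ∂(M.thetaKernel θ) ≤
      (M.m n + 2 * m') * M.ell n a b m' d' θ := by
  have hm' := h.m'_pos
  have ha := h.a_pos
  have hK : 0 ≤ M.m n + 2 * m' - 1 := by linarith [h.one_lt]
  have hm := M.one_le_m n
  rw [(integral_ell hβ1 hδ0 hδ1 n a b m' d' θ).2, ell]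
  set S := ∑ k ∈ Finset.range (n - 1), M.absExit k θ
  set G := M.g n θ
  set N := (n : ℝ) * |M.c₀|
  have hG : 0 ≤ m' * (a * G) := mul_nonneg hm'.le (mul_pos ha (M.g_pos n θ)).le
  have hSN : 0 ≤ (M.m n + 2 * m' - 1) * (m' * (S + N)) :=
    mul_nonneg hK (mul_nonneg hm'.le (add_nonneg (M.sum_absExit_nonneg _ θ) (by positivity)))
  have hb : 0 ≤ (M.m n + m' - 1) * b := mul_nonneg (by linarith) h.b_nonneg
  have hd : 0 ≤ (M.m n + 2 * m' - 1) * d' := mul_nonneg hK h.d'_pos.le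
  calc _ ≤ m' * (S + (a * G + b) + N) + (a * (M.m n * G) + b) + d' := by
        gcongr
        exacts [h.sum_absExit_succ_le θ, integral_g_le hρ n θ]
    _ = (M.m n + 2 * m') * (m' * (S + N) + (a * G + b) + d') -
          ((M.m n + 2 * m' - 1) * (m' * (S + N)) + m' * (a * G) + (M.m n + m' - 1) * b +
            (M.m n + 2 * m' - 1) * d') := by ring
    _ ≤ _ := by linarith

lemma memWeighted_integral_abs_exit (h : M.IsAdmissible n a b m' d') (hβ1 : M.β < 1)
    (hδ0 : 0 ≤ M.δ) (hδ1 : M.δ ≠ 1) (hρ : |M.ρ| ≤ 1) :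
    MemWeighted (M.ell n a b m' d') fun θ => ∫ z, |M.r z.1| ∂(M.thetaKernel θ) := by
  suffices ∃ C, ∀ θ, M.absExit 0 θ ≤ C * M.ell n a b m' d' θ by
    obtain ⟨C, hC⟩ := this
    exact .of_abs_le h.ell_pos (M.measurable_absExit 0) (B := C) fun θ =>
      (abs_of_nonneg (M.absExit_nonneg 0 θ)).trans_le (hC θ)
  rcases lt_or_ge n 2 with hn | hn
  · obtain ⟨A, B, hA, hB, hexit⟩ := exists_absExit_le hβ1 hδ0 hδ1 0
    have hexp : |(1 - M.δ) * M.ρ ^ (0 + 1)| ≤ |(1 - M.δ) * M.ρ ^ n| := by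
      rw [abs_mul, abs_mul, abs_pow, abs_pow]
      exact mul_le_mul_of_nonneg_left
        (pow_le_pow_of_le_one (abs_nonneg _) hρ (Nat.le_of_lt_succ hn)) (abs_nonneg _)
    refine ⟨A / d' + B / a, fun θ => ?_⟩
    calc M.absExit 0 θ ≤ A / d' * d' + B / a * (a * M.g n θ) := by
          rw [div_mul_cancel₀ _ h.d'_pos.ne', ← mul_assoc, div_mul_cancel₀ _ h.a_pos.ne']
          exact (hexit θ).2.trans (by gcongr; exact rpow_le_g hexp θ)
      _ ≤ A / d' * M.ell n a b m' d' θ + B / a * M.ell n a b m' d' θ :=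
          add_le_add
            (mul_le_mul_of_nonneg_left (h.le_ell θ).1 (div_nonneg hA h.d'_pos.le))
            (mul_le_mul_of_nonneg_left (h.le_ell θ).2.1 (div_nonneg hB h.a_pos.le))
      _ = _ := by ring
  · refine ⟨1 / m', fun θ => ?_⟩
    rw [div_mul_eq_mul_div, one_mul, le_div_iff₀' h.m'_pos]
    exact (mul_le_mul_of_nonneg_left (Finset.single_le_sum (f := fun k => M.absExit k θ)
      (fun k _ => M.absExit_nonneg k θ) (Finset.mem_range.2 (by lia))) h.m'_pos.le).trans
      (h.le_ell θ).2.2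

lemma isWeight (h : M.IsAdmissible n a b m' d') (hβ0 : 0 ≤ M.β) (hβ1 : M.β < 1)
    (hδ0 : 0 ≤ M.δ) (hδ1 : M.δ ≠ 1) (hρ : |M.ρ| ≤ 1) :
    M.IsWeight (M.ell n a b m' d') (M.m n + 2 * m') where
  measurable_proj := measurable_snd
  measurable := M.measurable_ell n a b m' d'
  pos := h.ell_pos
  growth_nonneg := zero_le_one.trans h.one_lt.le
  integrable θ := (integral_ell hβ1 hδ0 hδ1 n a b m' d' θ).1
  drift := h.integral_ell_le hβ1 hδ0 hδ1 hρ
  discount_nonneg := hβ0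
  discount := h.lt_one
  exit_measurable := M.measurable_exit
  exit_integrable := integrable_exit_stateLaw hβ1 hδ0 hδ1 0
  exit := h.memWeighted_integral_abs_exit hβ1 hδ0 hδ1 hρ
  flow := .of_abs_le h.ell_pos measurable_const (B := |M.c₀| / d') fun θ => by
    rw [div_mul_eq_mul_div, le_div_iff₀ h.d'_pos]
    exact mul_le_mul_of_nonneg_left (h.le_ell θ).1 (abs_nonneg _)

end IsAdmissible

lemma exists_isAdmissible (hβ0 : 0 < M.β) (hβ1 : M.β < 1) (hδ0 : 0 ≤ M.δ) (hδ1 : M.δ ≠ 1)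
    (hn : M.β * M.m n < 1) : ∃ a b m' d', M.IsAdmissible n a b m' d' := by
  have hm := M.one_le_m n
  obtain ⟨a, b, ha, hb, hbound⟩ : ∃ a b : ℝ, 0 < a ∧ 0 ≤ b ∧
      ∀ k, n = k + 2 → ∀ θ, M.absExit (k + 1) θ ≤ a * M.g n θ + b := by
    obtain ⟨A, B, hA, hB, hexit⟩ := exists_absExit_le hβ1 hδ0 hδ1 (n - 1)
    refine ⟨B + 1, A, by positivity, hA, ?_⟩
    rintro k rfl θ
    have hg := M.g_pos (k + 2) θ
    calc M.absExit (k + 1) θ ≤ A + B * M.g (k + 2) θ :=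
          (hexit θ).2.trans (by gcongr; exact rpow_le_g le_rfl θ)
      _ ≤ (B + 1) * M.g (k + 2) θ + A := by linarith
  set m' := (1 - M.β * M.m n) / (4 * M.β)
  have hm' : 0 < m' := div_pos (by linarith) (by linarith)
  have hβm' : M.β * m' = (1 - M.β * M.m n) / 4 := by
    simp only [m']
    field_simp
  have hK : 0 < M.m n + 2 * m' - 1 := by linarith
  exact ⟨a, b, m', a * M.m n / (M.m n + 2 * m' - 1), hn, ha, hb, hbound, hm',
    div_pos (by positivity) hK, by linarith, by linarith, le_rfl⟩

end Admissible

end JobSearch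

section GaussianSmoothing

section ExponentialFamily

variable {Ω : Type*} [MeasurableSpace Ω] {μ : Measure Ω} {X F : Ω → ℝ}

lemma contDiff_integral_exp_mul_of_nonneg {n : WithTop ℕ∞} (hF : Measurable F) (hF0 : 0 ≤ F)
    (hFi : ∀ t : ℝ, Integrable (fun ω => Real.exp (t * X ω) * F ω) μ) :
    ContDiff ℝ n fun t : ℝ => ∫ ω, Real.exp (t * X ω) * F ω ∂μ := by
  let ν := μ.withDensity fun ω => ENNReal.ofReal (F ω)
  have integrable_exp : ∀ t : ℝ, Integrable (fun ω => Real.exp (t * X ω)) ν := fun t => by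
    rw [integrable_withDensity_iff hF.ennreal_ofReal (ae_of_all _ fun _ => ENNReal.ofReal_lt_top)]
    simpa only [ENNReal.toReal_ofReal (hF0 _)] using hFi t
  have eq_mgf : (fun t : ℝ => ∫ ω, Real.exp (t * X ω) * F ω ∂μ) = mgf X ν := by
    funext t
    rw [mgf, integral_withDensity_eq_integral_toReal_smul hF.ennreal_ofReal
      (ae_of_all _ fun _ => ENNReal.ofReal_lt_top)]
    simp only [ENNReal.toReal_ofReal (hF0 _), smul_eq_mul, mul_comm]
  rw [eq_mgf, contDiff_iff_contDiffAt]
  intro t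
  have hexpSet : integrableExpSet X ν = univ := eq_univ_of_forall integrable_exp
  exact (analyticAt_mgf (by simp only [hexpSet, interior_univ, mem_univ])).contDiffAt

lemma contDiff_integral_exp_mul {n : WithTop ℕ∞} (hX : Measurable X) (hF : Measurable F)
    (hFi : ∀ t : ℝ, Integrable (fun ω => Real.exp (t * X ω) * F ω) μ) :
    ContDiff ℝ n fun t : ℝ => ∫ ω, Real.exp (t * X ω) * F ω ∂μ := by
  have integrable_part : ∀ G : Ω → ℝ, Measurable G → (∀ ω, |G ω| ≤ |F ω|) →
      ∀ t : ℝ, Integrable (fun ω => Real.exp (t * X ω) * G ω) μ := fun G hG hGF t =>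
    (hFi t).mono (by fun_prop) <| ae_of_all _ fun ω => by
      simp only [norm_mul, Real.norm_eq_abs]
      exact mul_le_mul_of_nonneg_left (hGF ω) (abs_nonneg _)
  have hpos := integrable_part (fun ω => max (F ω) 0) (by fun_prop) fun ω => by
    rw [abs_of_nonneg (le_max_right (F ω) 0)]
    exact max_le (le_abs_self _) (abs_nonneg _)
  have hneg := integrable_part (fun ω => max (-F ω) 0) (by fun_prop) fun ω => by
    rw [abs_of_nonneg (le_max_right (-F ω) 0)]
    exact max_le (neg_le_abs _) (abs_nonneg _)
  have hsplit : ∀ t ω, Real.exp (t * X ω) * F ω =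
      Real.exp (t * X ω) * max (F ω) 0 - Real.exp (t * X ω) * max (-F ω) 0 := fun t ω => by
    rw [← mul_sub, max_zero_sub_max_neg_zero_eq_self]
  simp only [hsplit, integral_sub (hpos _) (hneg _)]
  exact (contDiff_integral_exp_mul_of_nonneg (hF.max measurable_const)
    (fun _ => le_max_right _ _) hpos).sub
    (contDiff_integral_exp_mul_of_nonneg (hF.neg.max measurable_const)
      (fun _ => le_max_right _ _) hneg)

end ExponentialFamily

variable {E : Type*} [MeasurableSpace E] {σ : Measure E} {γ : ℝ≥0} {F : ℝ × E → ℝ}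

/-- Density of `N(x, γ)` with respect to `N(0, γ)`. -/
def gaussianTilt (γ : ℝ≥0) (x y : ℝ) : ℝ :=
  Real.exp (x / γ * y) * Real.exp (-(x ^ 2 / (2 * γ)))

lemma measurable_gaussianTilt (γ : ℝ≥0) (x : ℝ) : Measurable (gaussianTilt γ x) := by
  unfold gaussianTilt
  fun_prop

lemma measurable_ofReal_gaussianTilt_fst (γ : ℝ≥0) (x : ℝ) :
    Measurable fun p : ℝ × E => ENNReal.ofReal (gaussianTilt γ x p.1) :=
  ((measurable_gaussianTilt γ x).comp measurable_fst).ennreal_ofReal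

lemma gaussianTilt_pos (γ : ℝ≥0) (x y : ℝ) : 0 < gaussianTilt γ x y := by
  unfold gaussianTilt
  positivity

lemma gaussianReal_eq_withDensity_gaussianTilt (hγ : γ ≠ 0) (x : ℝ) :
    gaussianReal x γ =
      (gaussianReal 0 γ).withDensity fun y => ENNReal.ofReal (gaussianTilt γ x y) := by
  have hγ' : (γ : ℝ) ≠ 0 := NNReal.coe_ne_zero.2 hγ
  rw [gaussianReal_of_var_ne_zero _ hγ, gaussianReal_of_var_ne_zero _ hγ,
    ← withDensity_mul _ (measurable_gaussianPDF _ _)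
      (measurable_gaussianTilt γ x).ennreal_ofReal]
  congr 1
  funext y
  have complete_square : -(y - x) ^ 2 / (2 * γ) =
      -(y - 0) ^ 2 / (2 * γ) + (x / γ * y + -(x ^ 2 / (2 * γ))) := by
    field_simp
    ring
  rw [Pi.mul_apply, gaussianPDF, gaussianPDF, ← ENNReal.ofReal_mul (gaussianPDFReal_nonneg _ _ _),
    gaussianPDFReal, gaussianPDFReal, gaussianTilt, complete_square, Real.exp_add, Real.exp_add,
    ← mul_assoc]

variable [SFinite σ]

lemma gaussianReal_prod_eq_withDensity (hγ : γ ≠ 0) (x : ℝ) :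
    (gaussianReal x γ).prod σ = ((gaussianReal 0 γ).prod σ).withDensity fun p =>
      ENNReal.ofReal (gaussianTilt γ x p.1) := by
  rw [gaussianReal_eq_withDensity_gaussianTilt hγ x,
    prod_withDensity_left (measurable_gaussianTilt γ x).ennreal_ofReal]

lemma integrable_gaussianReal_prod_iff (hγ : γ ≠ 0) (x : ℝ) :
    Integrable F ((gaussianReal x γ).prod σ) ↔
      Integrable (fun p => Real.exp (x / γ * p.1) * F p) ((gaussianReal 0 γ).prod σ) := by
  rw [gaussianReal_prod_eq_withDensity hγ, integrable_withDensity_iff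
    (measurable_ofReal_gaussianTilt_fst γ x)
    (ae_of_all _ fun _ => ENNReal.ofReal_lt_top),
    ← integrable_const_mul_iff (Real.exp_pos (-(x ^ 2 / (2 * γ)))).ne'.isUnit
      fun p : ℝ × E => Real.exp (x / γ * p.1) * F p]
  refine integrable_congr (ae_of_all _ fun p => ?_)
  beta_reduce
  rw [ENNReal.toReal_ofReal (gaussianTilt_pos γ x p.1).le, gaussianTilt]
  ring

lemma integral_gaussianReal_prod (hγ : γ ≠ 0) (x : ℝ) :
    ∫ p, F p ∂(gaussianReal x γ).prod σ =
      Real.exp (-(x ^ 2 / (2 * γ))) *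
        ∫ p, Real.exp (x / γ * p.1) * F p ∂(gaussianReal 0 γ).prod σ := by
  rw [gaussianReal_prod_eq_withDensity hγ, integral_withDensity_eq_integral_toReal_smul
    (measurable_ofReal_gaussianTilt_fst γ x)
    (ae_of_all _ fun _ => ENNReal.ofReal_lt_top), ← integral_const_mul]
  refine integral_congr_ae (ae_of_all _ fun p => ?_)
  beta_reduce
  rw [ENNReal.toReal_ofReal (gaussianTilt_pos γ x p.1).le, gaussianTilt, smul_eq_mul]
  ring

lemma contDiff_integral_gaussianReal_prod {n : WithTop ℕ∞} (hγ : γ ≠ 0) (hF : Measurable F)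
    (hFi : ∀ x, Integrable F ((gaussianReal x γ).prod σ)) :
    ContDiff ℝ n fun x => ∫ p, F p ∂(gaussianReal x γ).prod σ := by
  have hexp : ∀ t : ℝ, Integrable (fun p : ℝ × E => Real.exp (t * p.1) * F p)
      ((gaussianReal 0 γ).prod σ) := fun t => by
    simpa only [mul_div_cancel_right₀ t (NNReal.coe_ne_zero.2 hγ)] using
      (integrable_gaussianReal_prod_iff hγ (t * γ)).1 (hFi _)
  rw [funext (integral_gaussianReal_prod hγ)]
  exact ((contDiff_id.pow 2).div_const _).neg.exp.mul
    ((contDiff_integral_exp_mul measurable_fst hF hexp).comp (contDiff_id.div_const _))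

end GaussianSmoothing

namespace JobSearch

/-- The next state `(w', θ')` as a function of `(log θ', ξ, η)`. -/
def logNext (p : ℝ × PosReal × PosReal) : PosReal × PosReal :=
  (wage ⟨Real.exp p.1, Real.exp_pos _⟩ p.2.1 p.2.2, ⟨Real.exp p.1, Real.exp_pos _⟩)

lemma measurable_logNext : Measurable logNext := by
  have measurable_exp_fst : Measurable fun p : ℝ × PosReal × PosReal =>
      (⟨Real.exp p.1, Real.exp_pos _⟩ : PosReal) := measurable_posExp.comp measurable_fst
  refine Measurable.prodMk ?_ measurable_exp_fst
  unfold wage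
  exact Measurable.subtype_mk (by fun_prop)

variable {M : JobSearch}

lemma nextTheta_exp (θ : PosReal) (y : ℝ) :
    M.nextTheta θ ⟨Real.exp y, Real.exp_pos y⟩ =
      ⟨Real.exp (M.ρ * Real.log θ + y), Real.exp_pos _⟩ := by
  apply Subtype.ext
  change (θ : ℝ) ^ M.ρ * Real.exp y = Real.exp (M.ρ * Real.log θ + y)
  rw [Real.exp_add, Real.rpow_def_of_pos θ.2, mul_comm M.ρ]

lemma thetaKernel_eq_map_logNext (θ : PosReal) :
    M.thetaKernel θ = ((gaussianReal (M.ρ * Real.log θ) M.γu).prod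
      ((logNormal 0 M.γξ).prod (logNormal M.μη M.γη))).map logNext := by
  set σ := (logNormal 0 M.γξ).prod (logNormal M.μη M.γη)
  set x := M.ρ * Real.log θ with hx
  have shockLaw_eq : M.shockLaw = ((gaussianReal 0 M.γu).prod σ).map
      (Prod.map (fun y : ℝ => (⟨Real.exp y, Real.exp_pos y⟩ : PosReal)) id) := by
    rw [← Measure.map_prod_map _ _ measurable_posExp measurable_id, Measure.map_id]
    rfl
  have shifted_eq : (gaussianReal x M.γu).prod σ =
      ((gaussianReal 0 M.γu).prod σ).map (Prod.map (x + ·) id) := by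
    rw [← Measure.map_prod_map _ _ (measurable_const_add x) measurable_id, Measure.map_id,
      gaussianReal_map_const_add, zero_add]
  change M.shockLaw.map (M.next θ) = _
  rw [shockLaw_eq, shifted_eq,
    Measure.map_map (M.measurable_next_right θ) (measurable_posExp.prodMap measurable_id),
    Measure.map_map measurable_logNext ((measurable_const_add x).prodMap measurable_id)]
  congr 1
  funext p
  simp only [Function.comp_apply, next, logNext, Prod.map_fst, Prod.map_snd, id, nextTheta_exp, hx]

lemma isC1_integral_thetaKernel (hγ : M.γu ≠ 0) {f : PosReal × PosReal → ℝ} (hf : Measurable f)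
    (hfi : ∀ θ, Integrable f (M.thetaKernel θ)) :
    IsC1 fun θ => ∫ z, f z ∂(M.thetaKernel θ) := by
  let σ := (logNormal 0 M.γξ).prod (logNormal M.μη M.γη)
  let I : ℝ → ℝ := fun x => ∫ p, f (logNext p) ∂(gaussianReal x M.γu).prod σ
  suffices hI : ContDiffOn ℝ 1 (fun y => I (M.ρ * Real.log y)) (Ioi 0) from
    ⟨_, hI, fun θ => by
      beta_reduce
      rw [thetaKernel_eq_map_logNext, integral_map measurable_logNext.aemeasurable
        hf.aestronglyMeasurable]⟩
  rcases eq_or_ne M.ρ 0 with hρ | hρ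
  · simpa only [hρ, zero_mul] using contDiffOn_const
  have hI : ∀ x, Integrable (fun p => f (logNext p)) ((gaussianReal x M.γu).prod σ) := fun x => by
    have h := hfi ⟨Real.exp (x / M.ρ), Real.exp_pos _⟩
    rwa [thetaKernel_eq_map_logNext, integrable_map_measure hf.aestronglyMeasurable
      measurable_logNext.aemeasurable, Real.log_exp, mul_div_cancel₀ x hρ] at h
  exact (contDiff_integral_gaussianReal_prod hγ (hf.comp measurable_logNext) hI).comp_contDiffOn
    (contDiffOn_const.mul (Real.contDiffOn_log.mono fun _ hy => ne_of_gt hy))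

end JobSearch

section Support

open Measure

variable (μ : ℝ) {γ : ℝ≥0}

lemma isOpenPosMeasure_gaussianReal (hγ : γ ≠ 0) : IsOpenPosMeasure (gaussianReal μ γ) :=
  (gaussianReal_absolutelyContinuous' μ hγ).isOpenPosMeasure

lemma isOpenPosMeasure_logNormal (hγ : γ ≠ 0) : IsOpenPosMeasure (logNormal μ γ) :=
  have := isOpenPosMeasure_gaussianReal μ hγ
  (Real.continuous_exp.subtype_mk _).isOpenPosMeasure_map fun w =>
    ⟨Real.log w, Subtype.ext (Real.exp_log w.2)⟩

end Support

lemma IsC1.continuous {f : PosReal → ℝ} (hf : IsC1 f) : Continuous f := by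
  obtain ⟨F, hF, hFf⟩ := hf
  exact (continuousOn_iff_continuous_domRestrict.1 hF.continuousOn).congr hFf

namespace JobSearch

section Recurrence

open scoped ENNReal

variable {M : JobSearch}

lemma log_nextTheta (θ u : PosReal) :
    Real.log (M.nextTheta θ u) = M.ρ * Real.log θ + Real.log u := by
  rw [nextTheta, Real.log_mul (Real.rpow_pos_of_pos θ.2 _).ne' (ne_of_gt u.2),
    Real.log_rpow θ.2]

lemma le_wage (θ ξ η : PosReal) : η ≤ wage θ ξ η := by
  change (η : ℝ) ≤ η + θ * ξ
  exact le_add_of_nonneg_right (mul_pos θ.2 ξ.2).le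

lemma measurable_log_theta : Measurable fun z : PosReal × PosReal => Real.log z.2 := by
  fun_prop

lemma integrable_log_shock : Integrable (fun s => Real.log s.1) M.shockLaw := by
  have integrable_log : Integrable (fun u : PosReal => Real.log u) (logNormal 0 M.γu) := by
    refine (integrable_map_measure
      (Real.measurable_log.comp measurable_subtype_coe).aestronglyMeasurable
      measurable_posExp.aemeasurable).2 ?_
    simp only [Function.comp_def, Real.log_exp]
    exact (memLp_id_gaussianReal 1).integrable le_rfl
  exact integrable_log.comp_fst _

lemma lintegral_enorm_log_thetaKernel_le (θ : PosReal) :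
    ∫⁻ z, ‖Real.log z.2‖ₑ ∂(M.thetaKernel θ) ≤
      ‖M.ρ‖ₑ * ‖Real.log θ‖ₑ + ∫⁻ s, ‖Real.log s.1‖ₑ ∂M.shockLaw := by
  change ∫⁻ z, ‖Real.log z.2‖ₑ ∂(M.shockLaw.map (M.next θ)) ≤ _
  rw [lintegral_map measurable_log_theta.enorm (M.measurable_next_right θ)]
  calc ∫⁻ s, ‖Real.log (M.nextTheta θ s.1)‖ₑ ∂M.shockLaw
      ≤ ∫⁻ s, (‖M.ρ‖ₑ * ‖Real.log θ‖ₑ + ‖Real.log s.1‖ₑ) ∂M.shockLaw :=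
        lintegral_mono fun s => by
          rw [log_nextTheta, ← enorm_mul]
          exact enorm_add_le _ _
    _ = _ := by rw [lintegral_add_left measurable_const, lintegral_const, measure_univ, mul_one]

lemma exists_le_of_abs_log_le {f : PosReal → PosReal} (hf : Continuous f) (R : ℝ) :
    ∃ B, ∀ θ : PosReal, |Real.log θ| ≤ R → f θ ≤ B := by
  have hexp : Continuous fun x : ℝ => (⟨Real.exp x, Real.exp_pos x⟩ : PosReal) :=
    Real.continuous_exp.subtype_mk _
  obtain ⟨B, hB⟩ :=
    (isCompact_Icc (a := -R) (b := R)).bddAbove_image (hf.comp hexp).continuousOn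
  refine ⟨B, fun θ hθ => hB ⟨Real.log θ, abs_le.1 hθ, ?_⟩⟩
  exact congrArg f (Subtype.ext (Real.exp_log θ.2))

/-- Tomorrow's wage exceeds its `η`-component, so a large `η` together with a moderate `u` beats
the threshold. -/
lemma exists_pos_le_thetaKernel (hu : M.γu ≠ 0) (hη : M.γη ≠ 0) (hρ : |M.ρ| ≤ 1)
    {wbar : PosReal → PosReal} (hw : Continuous wbar) (R : ℝ) :
    ∃ ε : ℝ≥0∞, ε ≠ 0 ∧ ∀ θ : PosReal, |Real.log θ| ≤ R →
      ε ≤ M.thetaKernel θ {z | wbar z.2 ≤ z.1} := by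
  obtain ⟨B, hB⟩ := exists_le_of_abs_log_le hw (R + 1)
  set U : Set PosReal := {u | |Real.log u| < 1}
  have hU : logNormal 0 M.γu U ≠ 0 := by
    have := isOpenPosMeasure_logNormal 0 hu
    have continuous_log : Continuous fun u : PosReal => Real.log u :=
      continuous_subtype_val.log fun u => ne_of_gt u.2
    exact (isOpen_lt continuous_log.abs continuous_const).measure_ne_zero _
      ⟨⟨1, mem_Ioi.2 one_pos⟩, by simp⟩
  have hIoi : logNormal M.μη M.γη (Ioi B) ≠ 0 := by
    have := isOpenPosMeasure_logNormal M.μη hη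
    exact isOpen_Ioi.measure_ne_zero _ nonempty_Ioi
  refine ⟨M.shockLaw (U ×ˢ univ ×ˢ Ioi B), ?_, fun θ hθ => ?_⟩
  · rw [shockLaw, Measure.prod_prod, Measure.prod_prod, measure_univ, one_mul]
    exact mul_ne_zero hU hIoi
  have measurableSet_accept : MeasurableSet {z : PosReal × PosReal | wbar z.2 ≤ z.1} :=
    measurableSet_le (hw.measurable.comp measurable_snd) measurable_fst
  change _ ≤ M.shockLaw.map (M.next θ) _
  rw [Measure.map_apply (M.measurable_next_right θ) measurableSet_accept]
  refine measure_mono fun s hs => ?_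
  have hnext : |Real.log (M.nextTheta θ s.1)| ≤ R + 1 := by
    rw [log_nextTheta]
    refine (abs_add_le _ _).trans (add_le_add ?_ (le_of_lt hs.1))
    rw [abs_mul]
    exact (mul_le_of_le_one_left (abs_nonneg _) hρ).trans hθ
  calc wbar (M.nextTheta θ s.1) ≤ B := hB _ hnext
    _ ≤ s.2.2 := le_of_lt hs.2.2
    _ ≤ wage (M.nextTheta θ s.1) s.2.1 s.2.2 := le_wage _ _ _

lemma isFiniteStoppingTime_hittingAfter_of_continuous_threshold (hu : M.γu ≠ 0) (hη : M.γη ≠ 0)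
    (hρ : |M.ρ| < 1) {wbar : PosReal → PosReal} (hw : Continuous wbar) (z : PosReal × PosReal) :
    OptStop.IsFiniteStoppingTime M.kernel z
      (hittingAfter (fun t ω => ω t) {z | wbar z.2 ≤ z.1} 0) := by
  refine OptStop.isFiniteStoppingTime_hittingAfter_of_affine_drift
    (V := fun z => ‖Real.log z.2‖ₑ) (a := ‖M.ρ‖ₑ) (b := ∫⁻ s, ‖Real.log s.1‖ₑ ∂M.shockLaw)
    measurable_log_theta.enorm enorm_ne_top ?_ integrable_log_shock.hasFiniteIntegral.ne
    (fun z => lintegral_enorm_log_thetaKernel_le z.2)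
    (measurableSet_le (hw.measurable.comp measurable_snd) measurable_fst) fun R hR => ?_
  · rwa [Real.enorm_eq_ofReal_abs, ENNReal.ofReal_lt_one]
  · obtain ⟨ε, hε, hεR⟩ := exists_pos_le_thetaKernel hu hη hρ.le hw R.toReal
    refine ⟨ε, hε, fun y hy => hεR y.2 ?_⟩
    rw [← Real.norm_eq_abs, ← toReal_enorm]
    exact ENNReal.toReal_mono hR hy

end Recurrence

section ReservationWage

lemma crra_pos {δ w : ℝ} (hδ : δ < 1) (hw : 0 < w) : 0 < crra δ w := by
  rw [crra, if_neg hδ.ne]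
  exact div_pos (Real.rpow_pos_of_pos hw _) (sub_pos.2 hδ)

lemma crra_neg {δ w : ℝ} (hδ : 1 < δ) (hw : 0 < w) : crra δ w < 0 := by
  rw [crra, if_neg hδ.ne']
  exact div_neg_of_pos_of_neg (Real.rpow_pos_of_pos hw _) (sub_neg.2 hδ)

variable {M : JobSearch}

lemma strictMono_r (hβ1 : M.β < 1) (hδ1 : M.δ ≠ 1) : StrictMono M.r := by
  intro x y (hxy : (x : ℝ) < y)
  have hβ : 0 < 1 - M.β := sub_pos.2 hβ1
  rw [r_eq hδ1, r_eq hδ1]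
  rcases lt_or_gt_of_ne (sub_ne_zero.2 hδ1.symm) with hδ | hδ
  · exact div_lt_div_of_neg_of_lt (mul_neg_of_pos_of_neg hβ hδ)
      (Real.rpow_lt_rpow_of_neg x.2 hxy hδ)
  · exact div_lt_div_of_pos_right (Real.rpow_lt_rpow (le_of_lt x.2) hxy hδ) (mul_pos hβ hδ)

lemma continuous_r (hδ1 : M.δ ≠ 1) : Continuous M.r := by
  rw [funext (r_eq hδ1)]
  exact (continuous_subtype_val.rpow_const fun w => .inl (ne_of_gt w.2)).div_const _

/-- The reservation wage `w̄(θ)` associated with a continuation value `ψ`. It exists only where `ψ`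
has the sign of `1 - δ`, which is what `hψ` records. -/
def reservationWage (M : JobSearch) (ψ : PosReal → ℝ)
    (hψ : ∀ θ, 0 < (1 - M.β) * (1 - M.δ) * ψ θ) (θ : PosReal) : PosReal :=
  ⟨((1 - M.β) * (1 - M.δ) * ψ θ) ^ (1 / (1 - M.δ)), Real.rpow_pos_of_pos (hψ θ) _⟩

variable {ψ : PosReal → ℝ} (hψ : ∀ θ, 0 < (1 - M.β) * (1 - M.δ) * ψ θ)

lemma r_eq_iff_eq_reservationWage (hβ1 : M.β < 1) (hδ1 : M.δ ≠ 1) (θ w : PosReal) :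
    M.r w = ψ θ ↔ w = M.reservationWage ψ hψ θ := by
  have hδ : 1 - M.δ ≠ 0 := sub_ne_zero.2 hδ1.symm
  have hscale : (1 - M.β) * (1 - M.δ) ≠ 0 := mul_ne_zero (sub_pos.2 hβ1).ne' hδ
  rw [Subtype.ext_iff]
  change _ ↔ (w : ℝ) = ((1 - M.β) * (1 - M.δ) * ψ θ) ^ (1 / (1 - M.δ))
  rw [r_eq hδ1, div_eq_iff hscale, mul_comm (ψ θ), one_div]
  exact (Real.eq_rpow_inv (le_of_lt w.2) (hψ θ).le hδ).symm

lemma reservationWage_le_iff (hβ1 : M.β < 1) (hδ1 : M.δ ≠ 1) (θ w : PosReal) :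
    M.reservationWage ψ hψ θ ≤ w ↔ ψ θ ≤ M.r w := by
  rw [← (strictMono_r hβ1 hδ1).le_iff_le, (r_eq_iff_eq_reservationWage hψ hβ1 hδ1 θ _).2 rfl]

lemma monotone_reservationWage (hβ1 : M.β < 1) (hδ1 : M.δ ≠ 1) (hmono : Monotone ψ) :
    Monotone (M.reservationWage ψ hψ) := by
  intro x y hxy
  rw [reservationWage_le_iff hψ hβ1 hδ1, (r_eq_iff_eq_reservationWage hψ hβ1 hδ1 y _).2 rfl]
  exact hmono hxy

lemma isC1_reservationWage (hC1 : IsC1 ψ) :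
    IsC1 fun θ => (M.reservationWage ψ hψ θ : ℝ) := by
  obtain ⟨F, hF, hFψ⟩ := hC1
  refine ⟨fun x => ((1 - M.β) * (1 - M.δ) * F x) ^ (1 / (1 - M.δ)), ?_, fun θ => ?_⟩
  · refine (contDiffOn_const.mul hF).rpow_const_of_ne fun x hx => ?_
    rw [show F x = ψ ⟨x, hx⟩ from hFψ ⟨x, hx⟩]
    exact (hψ _).ne'
  · beta_reduce
    rw [hFψ, reservationWage]

end ReservationWage

section FixedPoint

variable {M : JobSearch} {ℓ ψ : PosReal → ℝ} {K : ℝ}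

lemma isC1_Q (h : M.IsWeight ℓ K) (hu : M.γu ≠ 0) (hψ : MemWeighted ℓ ψ) : IsC1 (M.Q ψ) := by
  obtain ⟨F, hF, hFQ⟩ := isC1_integral_thetaKernel hu
    (M.measurable_exit.max (hψ.1.comp measurable_snd)) (h.integrable_max hψ)
  exact ⟨fun x => M.c₀ + M.β * F x, contDiffOn_const.add (contDiffOn_const.mul hF), fun θ =>
    congrArg (fun I => M.c₀ + M.β * I) (hFQ θ)⟩

lemma monotone_next (hρ : 0 ≤ M.ρ) (s : PosReal × PosReal × PosReal) :
    Monotone fun θ => M.next θ s := by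
  intro θ θ' (hθ : (θ : ℝ) ≤ θ')
  have hnext : (M.nextTheta θ s.1 : ℝ) ≤ M.nextTheta θ' s.1 :=
    mul_le_mul_of_nonneg_right (Real.rpow_le_rpow (le_of_lt θ.2) hθ hρ) (le_of_lt s.1.2)
  have hwage : (s.2.2 : ℝ) + M.nextTheta θ s.1 * s.2.1 ≤ s.2.2 + M.nextTheta θ' s.1 * s.2.1 :=
    add_le_add_right (mul_le_mul_of_nonneg_right hnext (le_of_lt s.2.1.2)) _
  exact ⟨hwage, hnext⟩

lemma monotone_Q (h : M.IsWeight ℓ K) (hβ1 : M.β < 1) (hδ1 : M.δ ≠ 1) (hρ : 0 ≤ M.ρ)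
    (hψ : MemWeighted ℓ ψ) (hmono : Monotone ψ) : Monotone (M.Q ψ) := by
  intro θ θ' hθ
  have hmax := M.measurable_exit.max (hψ.1.comp measurable_snd)
  have hint := fun θ => (M.integrable_thetaKernel_iff hmax θ).1 (h.integrable_max hψ θ)
  have hle : ∫ z, max (M.r z.1) (ψ z.2) ∂(M.thetaKernel θ) ≤
      ∫ z, max (M.r z.1) (ψ z.2) ∂(M.thetaKernel θ') := by
    refine (M.integral_thetaKernel hmax θ).trans_le
      (le_of_le_of_eq ?_ (M.integral_thetaKernel hmax θ').symm)
    exact integral_mono (hint θ) (hint θ') fun s =>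
      max_le_max ((strictMono_r hβ1 hδ1).monotone (monotone_next hρ s hθ).1)
        (hmono (monotone_next hρ s hθ).2)
  exact add_le_add_right (mul_le_mul_of_nonneg_left hle h.discount_nonneg) _

lemma monotone_of_fixed (h : M.IsWeight ℓ K) (hβ1 : M.β < 1) (hδ1 : M.δ ≠ 1) (hρ : 0 ≤ M.ρ)
    (hψ : MemWeighted ℓ ψ) (hfix : M.Q ψ = ψ) : Monotone ψ :=
  h.isWeightedContraction.fixed_mem_of_isClosed h.pos hψ hfix isClosed_monotone
    (fun _ hφ hmono => monotone_Q h hβ1 hδ1 hρ hφ hmono) .zero monotone_const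

/-- Both payoffs have the sign of `1 - δ`, and hence so has the continuation value. -/
lemma scaled_pos_of_fixed (h : M.IsWeight ℓ K) (hβ1 : M.β < 1) (hδ1 : M.δ ≠ 1)
    (hcomp : 0 < M.comp) (hψ : MemWeighted ℓ ψ) (hfix : M.Q ψ = ψ) (θ : PosReal) :
    0 < (1 - M.β) * (1 - M.δ) * ψ θ := by
  have hβ : 0 < 1 - M.β := sub_pos.2 hβ1
  rw [mul_assoc]
  refine mul_pos hβ ?_
  rcases lt_or_gt_of_ne hδ1 with hδ | hδ
  · have hr : ∀ z : PosReal × PosReal, 0 ≤ M.r z.1 := fun z =>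
      div_nonneg (crra_pos hδ z.1.2).le hβ.le
    have hψc : M.c₀ ≤ ψ θ := by
      rw [← hfix]
      exact flow_le_contOp (κ := M.thetaKernel) (π := Prod.snd) (c := fun _ => M.c₀)
        h.discount_nonneg hr θ
    exact mul_pos (sub_pos.2 hδ) ((crra_pos hδ hcomp).trans_le hψc)
  · have hr : ∀ z : PosReal × PosReal, M.r z.1 ≤ 0 := fun z =>
      div_nonpos_of_nonpos_of_nonneg (crra_neg hδ z.1.2).le hβ.le
    have hψc : ψ θ ≤ M.c₀ := h.fixed_le_flow hψ hfix hr (fun _ => (crra_neg hδ hcomp).le) θ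
    exact mul_pos_of_neg_of_neg (sub_neg.2 hδ) (hψc.trans_lt (crra_neg hδ hcomp))

lemma value_eq_and_isOptimalPolicy (h : M.IsWeight ℓ K) (hβ1 : M.β < 1) (hδ1 : M.δ ≠ 1)
    (hρ : |M.ρ| < 1) (hu : M.γu ≠ 0) (hη : M.γη ≠ 0) (hψ : MemWeighted ℓ ψ) (hfix : M.Q ψ = ψ)
    (hpos : ∀ θ, 0 < (1 - M.β) * (1 - M.δ) * ψ θ) :
    M.value = (fun z => max (M.r z.1) (ψ z.2)) ∧
      OptStop.IsOptimalPolicy M.kernel M.β (fun z => M.r z.1) (fun _ => M.c₀)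
        {z | M.reservationWage ψ hpos z.2 ≤ z.1} := by
  have hcont : Continuous (M.reservationWage ψ hpos) :=
    (isC1_reservationWage hpos (hfix ▸ isC1_Q h hu hψ)).continuous.subtype_mk _
  have hregion : {z : PosReal × PosReal | M.reservationWage ψ hpos z.2 ≤ z.1} =
      {z | ψ z.2 ≤ M.r z.1} := by
    simp only [reservationWage_le_iff hpos hβ1 hδ1]
  have hfinite := isFiniteStoppingTime_hittingAfter_of_continuous_threshold hu hη hρ hcont
  rw [hregion] at hfinite ⊢
  exact h.value_eq_and_isOptimalPolicy hψ hfix hfinite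

lemma contValue_mem_and_fixed (h : M.IsWeight ℓ K) (hβ1 : M.β < 1) (hδ1 : M.δ ≠ 1)
    (hρ : |M.ρ| < 1) (hcomp : 0 < M.comp) (hu : M.γu ≠ 0) (hη : M.γη ≠ 0) :
    MemWeighted ℓ M.contValue ∧ M.Q M.contValue = M.contValue := by
  obtain ⟨ψ, hψ, hfix⟩ := h.isWeightedContraction.exists_fixed h.pos
  have hval := (value_eq_and_isOptimalPolicy h hβ1 hδ1 hρ hu hη hψ hfix
    (scaled_pos_of_fixed h hβ1 hδ1 hcomp hψ hfix)).1
  have hcontValue : M.contValue = ψ := by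
    funext θ
    rw [contValue, hval]
    exact congrFun hfix θ
  exact hcontValue ▸ ⟨hψ, hfix⟩

end FixedPoint

end JobSearch

end

theorem mainTheorem12 (M : JobSearch)
    (hβ0 : 0 < M.β) (hβ1 : M.β < 1)
    (hδ0 : 0 ≤ M.δ) (hδ1 : M.δ ≠ 1)
    (hρ0 : -1 < M.ρ) (hρ1 : M.ρ < 1)
    (hcomp : 0 < M.comp)
    (hu : 0 < M.γu) (hξ : 0 < M.γξ) (hη : 0 < M.γη) :
    -- the expectations that enter the weight functions are finite
    (∀ k θ, Integrable (fun z : PosReal × PosReal => M.r z.1) (M.stateLaw k θ)) ∧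
    -- the weight functions of the statement exist, for some and indeed every suitable `n`
    (∃ n, M.β * M.m n < 1) ∧
    (∀ n, M.β * M.m n < 1 → ∃ a b m' d', M.IsAdmissible n a b m' d') ∧
    -- the value function and the continuation value function are well defined
    OptStop.ValueWellDefined M.kernel M.β (fun z => M.r z.1) (fun _ => M.c₀) ∧
    (∀ θ, Integrable M.value (M.thetaKernel θ)) ∧
    -- 1. `Q` is a contraction with unique fixed point `ψ*`
    (∀ n a b m' d', M.IsAdmissible n a b m' d' →
      (∀ θ, 0 < M.ell n a b m' d' θ) ∧
      (∀ ψ, MemWeighted (M.ell n a b m' d') ψ →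
        ∀ θ, Integrable (fun z : PosReal × PosReal => max (M.r z.1) (ψ z.2)) (M.thetaKernel θ)) ∧
      IsWeightedContraction (M.ell n a b m' d') M.Q ∧
      MemWeighted (M.ell n a b m' d') M.contValue ∧
      M.Q M.contValue = M.contValue ∧
      (∀ ψ, MemWeighted (M.ell n a b m' d') ψ → M.Q ψ = ψ → ψ = M.contValue)) ∧
    -- 2. value function, reservation wage and optimal policy; 3. smoothness; 4. monotonicity
    (∀ z, M.value z =
      max ((z.1 : ℝ) ^ (1 - M.δ) / ((1 - M.β) * (1 - M.δ))) (M.contValue z.2)) ∧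
    (∃ wbar : PosReal → PosReal,
      (∀ θ w, M.r w = M.contValue θ ↔ w = wbar θ) ∧
      (∀ θ, 0 < (1 - M.β) * (1 - M.δ) * M.contValue θ) ∧
      (∀ θ, (wbar θ : ℝ) = ((1 - M.β) * (1 - M.δ) * M.contValue θ) ^ (1 / (1 - M.δ))) ∧
      OptStop.IsOptimalPolicy M.kernel M.β (fun z => M.r z.1) (fun _ => M.c₀)
        {z | wbar z.2 ≤ z.1} ∧
      IsC1 (fun θ => (wbar θ : ℝ)) ∧
      (0 ≤ M.ρ → Monotone wbar)) ∧
    IsC1 M.contValue ∧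
    Continuous M.value ∧
    (∀ θ, Monotone fun w => M.value (w, θ)) ∧
    (0 ≤ M.ρ → Monotone M.contValue ∧ ∀ w, Monotone fun θ => M.value (w, θ)) := by
  have hρ : |M.ρ| < 1 := abs_lt.2 ⟨hρ0, hρ1⟩
  have hweight {n a b m' d'} (h : M.IsAdmissible n a b m' d') := h.isWeight hβ0.le hβ1 hδ0 hδ1 hρ.le
  have hsolution {ℓ K} (h : M.IsWeight ℓ K) :=
    JobSearch.contValue_mem_and_fixed h hβ1 hδ1 hρ hcomp hu.ne' hη.ne'
  obtain ⟨n, hn⟩ := M.exists_mul_m_lt_one hβ1 hρ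
  obtain ⟨a, b, m', d', hadm⟩ := M.exists_isAdmissible hβ0 hβ1 hδ0 hδ1 hn
  have hw := hweight hadm
  obtain ⟨hψ, hfix⟩ := hsolution hw
  have hpos := JobSearch.scaled_pos_of_fixed hw hβ1 hδ1 hcomp hψ hfix
  obtain ⟨hval, hopt⟩ :=
    JobSearch.value_eq_and_isOptimalPolicy hw hβ1 hδ1 hρ hu.ne' hη.ne' hψ hfix hpos
  have hC1 : IsC1 M.contValue := hfix ▸ JobSearch.isC1_Q hw hu.ne' hψ
  have hmono (hρ : 0 ≤ M.ρ) := JobSearch.monotone_of_fixed hw hβ1 hδ1 hρ hψ hfix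
  refine ⟨M.integrable_exit_stateLaw hβ1 hδ0 hδ1, ⟨n, hn⟩,
    fun n hn => M.exists_isAdmissible hβ0 hβ1 hδ0 hδ1 hn, hw.valueWellDefined,
    hval ▸ hw.integrable_max hψ, fun n a b m' d' h => ?_, fun z => ?_, ?_, hC1, ?_, ?_, ?_⟩
  · have hw := hweight h
    obtain ⟨hψ, hfix⟩ := hsolution hw
    exact ⟨hw.pos, fun φ => hw.integrable_max, hw.isWeightedContraction, hψ, hfix,
      fun φ hφ hφfix => hw.isWeightedContraction.eq_of_fixed hw.pos hφ hψ hφfix hfix⟩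
  · rw [← M.r_eq hδ1, congrFun hval z]
  · exact ⟨M.reservationWage M.contValue hpos,
      JobSearch.r_eq_iff_eq_reservationWage hpos hβ1 hδ1, hpos, fun θ => rfl, hopt,
      JobSearch.isC1_reservationWage hpos hC1,
      fun hρ => JobSearch.monotone_reservationWage hpos hβ1 hδ1 (hmono hρ)⟩
  · rw [hval]
    exact ((JobSearch.continuous_r hδ1).comp continuous_fst).max
      (hC1.continuous.comp continuous_snd)
  · rw [hval]
    exact fun θ w w' hw => max_le_max_right _ ((JobSearch.strictMono_r hβ1 hδ1).monotone hw)
  · rw [hval]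
    exact fun hρ => ⟨hmono hρ, fun w θ θ' hθ => max_le_max_left _ (hmono hρ hθ)⟩
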